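/- Let $G(u)=-\tfrac12u^2+\tfrac14u^4$, so $G'(u)=-u+u^3$. For $1\le n<\infty$ let $P_n$ denote truncation of the Fourier series of a $2\pi$-periodic function of $\tau$, $(P_nf)(\tau)=\sum_{|\ell|\le n}\hat f_\ell e^{i\ell\tau}$, and let $P_\infty=\mathrm{id}$. For real parameters $s,\omega\neq0$ and $1\le n\le\infty$ consider the (Galerkin-truncated) modulated traveling-wave equation of the Cahn–Hilliard equation, for real functions $u=u(\xi,\tau)$, $\xi\in\mathbb R$, that are $2\pi$-periodic in $\tau$, written as the first-order system $$u_\xi=v,\qquad v_\xi=P_nG'(u)+\theta,\qquad \theta_\xi=w,\qquad w_\xi=sv-\omega u_\tau .$$ Here $v,\theta,w$ are determined by $u$. For a solution let $$I(u)=\frac1{2\pi}\int_0^{2\pi}\bigl(w(\xi,\tau)-s\,u(\xi,\tau)\bigr)\,d\tau ,$$ which does not depend on $\xi$. Fix $\eta>0$, put $\chi(\xi)=1/\cosh(\eta\xi)$, and define the uniformly local norm $$\|u\|_{L^4_{\mathrm{unif}}}=\sup_{\xi_0\in\mathbb R}\|\chi(\cdot-\xi_0)\,u\|_{L^4(\mathbb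 R\times(0,2\pi))}.$$ **Proposition (a priori estimates).** There is a function $C(I,s,\omega)$ (depending also on the fixed weight parameter $\eta$, but not on $n$ or on $u$) such that for all $s,\omega\neq0$, all $1\le n\le\infty$ and all solutions of the system for which $u$ is smooth ($C^\infty$ on $\mathbb R^2$) and bounded, $$\|u\|_{L^4_{\mathrm{unif}}}\le C(I(u),s,\omega).$$ -/

import Mathlib

noncomputable section

/-- The Fourier coefficient `(1 / 2π) ∫₀^{2π} f(τ) e^{-iℓτ} dτ` of a `2π`-periodic function. -/
def fourierMode (f : ℝ → ℝ) (l : ℤ) : ℂ :=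
  (2 * Real.pi : ℂ)⁻¹ *
    ∫ t in (0 : ℝ)..(2 * Real.pi), (f t : ℂ) * Complex.exp (-(Complex.I * l * t))

/-- The symmetric Fourier sum `∑_{|ℓ| ≤ n} f̂_ℓ e^{iℓτ}`. -/
def fourierSum (n : ℕ) (f : ℝ → ℝ) (t : ℝ) : ℂ :=
  ∑ l ∈ Finset.Icc (-(n : ℤ)) (n : ℤ), fourierMode f l * Complex.exp (Complex.I * l * t)

/-- The Galerkin projection `P_n` on `2π`-periodic real functions, with `P_∞ = id`. For finite `n`
the Fourier sum of a real function is real (`galerkin_coe`), so that nothing is lost by `re`. -/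
def galerkin (n : ℕ∞) (f : ℝ → ℝ) (t : ℝ) : ℝ :=
  match n with
  | ⊤ => f t
  | (k : ℕ) => (fourierSum k f t).re

lemma fourierMode_conj (f : ℝ → ℝ) (l : ℤ) :
    (starRingEnd ℂ) (fourierMode f l) = fourierMode f (-l) := by
  have h : ∀ g : ℝ → ℂ, (starRingEnd ℂ) (∫ t in (0 : ℝ)..(2 * Real.pi), g t) =
      ∫ t in (0 : ℝ)..(2 * Real.pi), (starRingEnd ℂ) (g t) := by
    intro g
    rw [intervalIntegral.integral_of_le (by positivity),
      intervalIntegral.integral_of_le (by positivity), integral_conj]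
  simp [fourierMode, h, ← Complex.exp_conj, Complex.conj_ofNat]

lemma galerkin_coe (k : ℕ) (f : ℝ → ℝ) (t : ℝ) :
    ((galerkin (k : ℕ∞) f t : ℝ) : ℂ) = fourierSum k f t := by
  have h : (starRingEnd ℂ) (fourierSum k f t) = fourierSum k f t := by
    unfold fourierSum
    rw [map_sum]
    refine Finset.sum_nbij' (fun l => -l) (fun l => -l) ?_ ?_ ?_ ?_ ?_
    · intro l hl; simp only [Finset.mem_Icc] at hl ⊢; omega
    · intro l hl; simp only [Finset.mem_Icc] at hl ⊢; omega
    · simp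
    · simp
    · intro l _
      simp [fourierMode_conj, ← Complex.exp_conj]
  exact Complex.conj_eq_iff_re.mp h

/-- The derivative `G'(u) = -u + u³` of the double-well potential `G(u) = -u²/2 + u⁴/4`. -/
def potentialDeriv (r : ℝ) : ℝ := -r + r ^ 3

/-- `(u, v, θ, w)`, as functions of `(ξ, τ)`, solves the (Galerkin-truncated) modulated
traveling-wave system
`u_ξ = v`, `v_ξ = P_n G'(u) + θ`, `θ_ξ = w`, `w_ξ = s v - ω u_τ`,
with `u` being `2π`-periodic in `τ`. -/
structure IsModulatedWave (n : ℕ∞) (s ω : ℝ) (u v θ w : ℝ → ℝ → ℝ) : Prop where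
  periodic : ∀ ξ, Function.Periodic (u ξ) (2 * Real.pi)
  u_eq : ∀ ξ τ, HasDerivAt (fun x => u x τ) (v ξ τ) ξ
  v_eq : ∀ ξ τ, HasDerivAt (fun x => v x τ)
    (galerkin n (fun t => potentialDeriv (u ξ t)) τ + θ ξ τ) ξ
  θ_eq : ∀ ξ τ, HasDerivAt (fun x => θ x τ) (w ξ τ) ξ
  w_eq : ∀ ξ τ, HasDerivAt (fun x => w x τ) (s * v ξ τ - ω * deriv (u ξ) τ) ξ

/-- The first integral `I = ⨍₀^{2π} (w - s u) dτ`, evaluated at `ξ`. -/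
def firstIntegral (s : ℝ) (u w : ℝ → ℝ → ℝ) (ξ : ℝ) : ℝ :=
  ⨍ τ in (0 : ℝ)..(2 * Real.pi), (w ξ τ - s * u ξ τ)

/-- The uniformly local norm `sup_{ξ₀} ‖χ(· - ξ₀) u‖_{L^p(ℝ × S¹)}` with `χ(ξ) = 1 / cosh(η ξ)`,
as an extended nonnegative number; the circle is represented by the period `(0, 2π]`. -/
def unifLpNorm (η : ℝ) (p : ENNReal) (u : ℝ → ℝ → ℝ) : ENNReal :=
  ⨆ ξ₀ : ℝ, MeasureTheory.eLpNorm
    (fun z : ℝ × ℝ => (Real.cosh (η * (z.1 - ξ₀)))⁻¹ * u z.1 z.2) p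
    (MeasureTheory.volume.restrict (Set.univ ×ˢ Set.Ioc (0 : ℝ) (2 * Real.pi)))

end

/-! The wave carries an almost monotone energy. Let `Z` be the mean-zero τ-primitive of w - su - I;
then Z_ξ = -ω(u - mean u). `waveEnergy` is built so that every term of its ξ-derivative containing θ
or Z cancels, leaving the period integral of v² + (u³ - u)(u + I/s) (`hasDerivAt_energy`). This is
at least half the integral of u⁴ minus a constant D depending only on I/s. Hence the growth of the
energy over a unit interval, plus D, dominates half the L⁴ mass there (`energy_sub_ge`).

Conversely, the local mass controls the energy. Averaged against a weight vanishing to third order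
at both ends, the energy can be integrated by parts until v and the product θZ are gone
(`integral_bump_mul_energy`). What remains involves u, Z and the mean of θ, and the last two are
again estimated by moving ξ-derivatives onto the weight. Near monotonicity turns the averaged bound
into an upper bound at the left end and a lower bound at the right end of the interval
(`exists_energy_bound`).

Since u is bounded, the energy has a finite supremum and infimum. At a point where it is within 1 of
the supremum, it grows by at most 1 over the next unit interval, so the mass there is at most 2(1 +
D), and the previous paragraph bounds the supremum independently of the size of u. The infimum is
treated by looking backwards. The energy thus has controlled range, and so the mass is controlled on
every unit interval (`exists_mass_bound`).

Uniformity in n rests on two facts. First, primitives of P_n g are bounded by the L¹ norm of g,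
because the partial sums of the sawtooth series are uniformly bounded (`abs_integral_galerkin_le`).
Second, the modes of a bounded wave above n solve a linear equation whose characteristic roots are
simple and off the imaginary axis, so they vanish (`bounded_solution_eq_zero`). Therefore P_n fixes
u and Z, and by symmetry it can be dropped wherever the nonlinearity is paired with them. -/

open MeasureTheory Function

/-! ### Integrals over one period -/

/-- Differentiation under the integral sign for jointly continuous derivatives. -/
lemma hasDerivAt_integral_of_continuous {E : Type*} [NormedAddCommGroup E] [NormedSpace ℝ E]
    {F F' : ℝ → ℝ → E} (hF : ∀ x, Continuous (F x)) (hF' : Continuous (uncurry F'))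
    (h : ∀ x t, HasDerivAt (fun y => F y t) (F' x t) x) (a b x : ℝ) :
    HasDerivAt (fun y => ∫ t in a..b, F y t) (∫ t in a..b, F' x t) x := by
  obtain ⟨C, hC⟩ := ((isCompact_closedBall x 1).prod
    (isCompact_uIcc (a := a) (b := b))).exists_bound_of_continuousOn hF'.continuousOn
  have hc : ∀ x, Continuous (F' x) := fun x => hF'.comp (by fun_prop : Continuous fun t => (x, t))
  refine (intervalIntegral.hasDerivAt_integral_of_dominated_loc_of_deriv_le (bound := fun _ => C)
    (Metric.closedBall_mem_nhds x one_pos) (.of_forall fun y => (hF y).aestronglyMeasurable)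
    ((hF x).intervalIntegrable _ _) (hc x).aestronglyMeasurable (.of_forall fun t ht y hy => ?_)
    (by simp) (.of_forall fun t _ y _ => h y t)).2
  exact hC (y, t) ⟨hy, Set.uIoc_subset_uIcc ht⟩

/-- The integral over one period. -/
noncomputable def circInt (g : ℝ → ℝ) : ℝ := ∫ t in (0 : ℝ)..(2 * Real.pi), g t

section circInt

variable {f g : ℝ → ℝ}

lemma circInt_add (hf : Continuous f) (hg : Continuous g) :
    circInt (fun t => f t + g t) = circInt f + circInt g :=
  intervalIntegral.integral_add (hf.intervalIntegrable _ _) (hg.intervalIntegrable _ _)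

lemma circInt_sub (hf : Continuous f) (hg : Continuous g) :
    circInt (fun t => f t - g t) = circInt f - circInt g :=
  intervalIntegral.integral_sub (hf.intervalIntegrable _ _) (hg.intervalIntegrable _ _)

lemma circInt_const_mul (c : ℝ) (f : ℝ → ℝ) : circInt (fun t => c * f t) = c * circInt f :=
  intervalIntegral.integral_const_mul _ _

lemma circInt_const (c : ℝ) : circInt (fun _ => c) = 2 * Real.pi * c := by
  simp [circInt]

lemma circInt_mono (hf : Continuous f) (hg : Continuous g) (h : ∀ t, f t ≤ g t) :
    circInt f ≤ circInt g :=
  intervalIntegral.integral_mono (by positivity) (hf.intervalIntegrable _ _)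
    (hg.intervalIntegrable _ _) h

lemma abs_circInt_le (hf : Continuous f) (hg : Continuous g) (h : ∀ t, |f t| ≤ g t) :
    |circInt f| ≤ circInt g :=
  (intervalIntegral.abs_integral_le_integral_abs (by positivity)).trans
    (circInt_mono hf.abs hg h)

lemma circInt_mono_on (hf : Continuous f) (hg : Continuous g)
    (h : ∀ t ∈ Set.Icc 0 (2 * Real.pi), f t ≤ g t) : circInt f ≤ circInt g :=
  intervalIntegral.integral_mono_on (by positivity) (hf.intervalIntegrable _ _)
    (hg.intervalIntegrable _ _) h

lemma abs_circInt_le_of_bound (hf : Continuous f) {C : ℝ}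
    (h : ∀ t ∈ Set.Icc 0 (2 * Real.pi), |f t| ≤ C) : |circInt f| ≤ 2 * Real.pi * C := by
  rw [← circInt_const]
  exact (intervalIntegral.abs_integral_le_integral_abs (by positivity)).trans
    (circInt_mono_on hf.abs continuous_const h)

lemma hasDerivAt_circInt {F F' : ℝ → ℝ → ℝ} (hF : ∀ x, Continuous (F x))
    (hF' : Continuous (uncurry F')) (h : ∀ x t, HasDerivAt (fun y => F y t) (F' x t) x) (x : ℝ) :
    HasDerivAt (fun y => circInt (F y)) (circInt (F' x)) x :=
  hasDerivAt_integral_of_continuous hF hF' h _ _ x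

lemma continuous_circInt {F : ℝ → ℝ → ℝ} (hF : Continuous (uncurry F)) :
    Continuous fun x => circInt (F x) :=
  intervalIntegral.continuous_parametric_intervalIntegral_of_continuous' hF _ _

end circInt

lemma abs_integral_le_of_mem_Icc {f g : ℝ → ℝ} (hf : Continuous f) (hg : Continuous g)
    (h : ∀ t, |f t| ≤ g t) {a b c d : ℝ} (ha : a ∈ Set.Icc c d) (hb : b ∈ Set.Icc c d) :
    |∫ t in a..b, f t| ≤ ∫ t in c..d, g t := by
  have key : ∀ a b : ℝ, a ∈ Set.Icc c d → b ∈ Set.Icc c d → a ≤ b →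
      |∫ t in a..b, f t| ≤ ∫ t in c..d, g t := by
    intro a b ha hb hab
    refine (intervalIntegral.abs_integral_le_integral_abs hab).trans ?_
    refine (intervalIntegral.integral_mono hab (hf.abs.intervalIntegrable _ _)
      (hg.intervalIntegrable _ _) h).trans ?_
    exact intervalIntegral.integral_mono_interval ha.1 hab hb.2
      (.of_forall fun t => (abs_nonneg _).trans (h t)) (hg.intervalIntegrable _ _)
  rcases le_total a b with hab | hab
  · exact key a b ha hb hab
  · rw [intervalIntegral.integral_symm, abs_neg]
    exact key b a hb ha hab

lemma sq_integral_le {g : ℝ → ℝ} (hg : Continuous g) {a b : ℝ} (hab : a ≤ b) :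
    (∫ t in a..b, g t) ^ 2 ≤ (b - a) * ∫ t in a..b, g t ^ 2 := by
  rcases hab.eq_or_lt with rfl | hab'
  · simp
  -- With c the mean of g, the claim is the nonnegativity of the variance.
  set c := (∫ t in a..b, g t) / (b - a) with hc
  have hp : 0 < b - a := sub_pos.2 hab'
  have h0 : 0 ≤ ∫ t in a..b, (g t - c) ^ 2 :=
    intervalIntegral.integral_nonneg hab fun t _ => sq_nonneg _
  have h1 : ∫ t in a..b, (g t - c) ^ 2 =
      (∫ t in a..b, g t ^ 2) - 2 * c * (∫ t in a..b, g t) + (b - a) * c ^ 2 := by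
    have : ∀ t, (g t - c) ^ 2 = g t ^ 2 - 2 * c * g t + c ^ 2 := fun t => by ring
    simp only [this]
    rw [intervalIntegral.integral_add, intervalIntegral.integral_sub,
      intervalIntegral.integral_const_mul]
    · simp
    all_goals exact Continuous.intervalIntegrable (by fun_prop) _ _
  have h2 : (∫ t in a..b, g t) = c * (b - a) := by rw [hc]; field_simp
  rw [h1] at h0
  rw [h2] at h0 ⊢
  nlinarith [mul_nonneg hp.le h0]

lemma pow_four_integral_le {g : ℝ → ℝ} (hg : Continuous g) {a b : ℝ} (hab : a ≤ b) :
    (∫ t in a..b, g t) ^ 4 ≤ (b - a) ^ 3 * ∫ t in a..b, g t ^ 4 := by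
  have h1 := sq_integral_le hg hab
  have h2 := sq_integral_le (g := fun t => g t ^ 2) (by fun_prop) hab
  have hp : 0 ≤ b - a := sub_nonneg.2 hab
  have h3 : ∀ t, (g t ^ 2) ^ 2 = g t ^ 4 := fun t => by ring
  simp only [h3] at h2
  calc (∫ t in a..b, g t) ^ 4 = ((∫ t in a..b, g t) ^ 2) ^ 2 := by ring
    _ ≤ ((b - a) * ∫ t in a..b, g t ^ 2) ^ 2 := by gcongr
    _ = (b - a) ^ 2 * (∫ t in a..b, g t ^ 2) ^ 2 := by ring
    _ ≤ (b - a) ^ 2 * ((b - a) * ∫ t in a..b, g t ^ 4) := by gcongr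
    _ = _ := by ring

/-! ### A polynomial weight on the unit interval -/

/-- The test function `φ(x) = x³(1-x)³` on `[0, 1]`. -/
noncomputable def bump (x : ℝ) : ℝ := x ^ 3 - 3 * x ^ 4 + 3 * x ^ 5 - x ^ 6
/-- The first derivative of `bump`. -/
noncomputable def bump₁ (x : ℝ) : ℝ := 3 * x ^ 2 - 12 * x ^ 3 + 15 * x ^ 4 - 6 * x ^ 5
/-- The second derivative of `bump`. -/
noncomputable def bump₂ (x : ℝ) : ℝ := 6 * x - 36 * x ^ 2 + 60 * x ^ 3 - 30 * x ^ 4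
/-- The third derivative of `bump`. -/
noncomputable def bump₃ (x : ℝ) : ℝ := 6 - 72 * x + 180 * x ^ 2 - 120 * x ^ 3

lemma hasDerivAt_bump (x : ℝ) : HasDerivAt bump (bump₁ x) x := by
  have h := (((hasDerivAt_pow 3 x).sub ((hasDerivAt_pow 4 x).const_mul 3)).add
    ((hasDerivAt_pow 5 x).const_mul 3)).sub (hasDerivAt_pow 6 x)
  refine h.congr_deriv ?_
  simp only [bump₁]; norm_num; ring

lemma hasDerivAt_bump₁ (x : ℝ) : HasDerivAt bump₁ (bump₂ x) x := by
  have h := ((((hasDerivAt_pow 2 x).const_mul 3).sub ((hasDerivAt_pow 3 x).const_mul 12)).add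
    ((hasDerivAt_pow 4 x).const_mul 15)).sub ((hasDerivAt_pow 5 x).const_mul 6)
  refine h.congr_deriv ?_
  simp only [bump₂]; norm_num; ring

lemma hasDerivAt_bump₂ (x : ℝ) : HasDerivAt bump₂ (bump₃ x) x := by
  have h := ((((hasDerivAt_id x).const_mul 6).sub ((hasDerivAt_pow 2 x).const_mul 36)).add
    ((hasDerivAt_pow 3 x).const_mul 60)).sub ((hasDerivAt_pow 4 x).const_mul 30)
  refine h.congr_deriv ?_
  simp only [bump₃]; norm_num; ring

@[fun_prop] lemma continuous_bump : Continuous bump := by unfold bump; fun_prop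
@[fun_prop] lemma continuous_bump₁ : Continuous bump₁ := by unfold bump₁; fun_prop
@[fun_prop] lemma continuous_bump₂ : Continuous bump₂ := by unfold bump₂; fun_prop
@[fun_prop] lemma continuous_bump₃ : Continuous bump₃ := by unfold bump₃; fun_prop

lemma bump_nonneg {x : ℝ} (hx : x ∈ Set.Icc (0 : ℝ) 1) : 0 ≤ bump x := by
  have : bump x = x ^ 3 * (1 - x) ^ 3 := by unfold bump; ring
  rw [this]
  exact mul_nonneg (pow_nonneg hx.1 _) (pow_nonneg (by linarith [hx.2]) _)

lemma integral_bump : ∫ x in (0 : ℝ)..1, bump x = 1 / 140 := by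
  unfold bump
  rw [intervalIntegral.integral_sub, intervalIntegral.integral_add, intervalIntegral.integral_sub]
  · simp only [intervalIntegral.integral_const_mul, integral_pow]; norm_num
  all_goals exact Continuous.intervalIntegrable (by fun_prop) _ _

/-- The constant 378 = 6 + 72 + 180 + 120 is the sum of the absolute coefficients of `bump₃`, the
largest such sum among the four polynomials. -/
lemma abs_bump_le {x : ℝ} (hx : x ∈ Set.Icc (0 : ℝ) 1) :
    |bump x| ≤ 378 ∧ |bump₁ x| ≤ 378 ∧ |bump₂ x| ≤ 378 ∧ |bump₃ x| ≤ 378 := by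
  have h : ∀ k : ℕ, 0 ≤ x ^ k ∧ x ^ k ≤ 1 := fun k =>
    ⟨pow_nonneg hx.1 _, pow_le_one₀ hx.1 hx.2⟩
  have h2 := h 2; have h3 := h 3; have h4 := h 4; have h5 := h 5; have h6 := h 6
  obtain ⟨h0, h1⟩ := hx
  simp only [abs_le, bump, bump₁, bump₂, bump₃]
  refine ⟨⟨?_, ?_⟩, ⟨?_, ?_⟩, ⟨?_, ?_⟩, ⟨?_, ?_⟩⟩ <;>
    linarith [h2.1, h2.2, h3.1, h3.2, h4.1, h4.2, h5.1, h5.2, h6.1, h6.2]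

lemma integral_mul_deriv_of_zero {φ φ' G g : ℝ → ℝ} (hφ : ∀ x, HasDerivAt φ (φ' x) x)
    (hφ' : Continuous φ') (hG : ∀ x, HasDerivAt G (g x) x) (hg : Continuous g)
    (h0 : φ 0 = 0) (h1 : φ 1 = 0) :
    ∫ x in (0 : ℝ)..1, φ x * g x = -∫ x in (0 : ℝ)..1, φ' x * G x := by
  rw [intervalIntegral.integral_mul_deriv_eq_deriv_mul (fun x _ => hφ x) (fun x _ => hG x)
    (hφ'.intervalIntegrable _ _) (hg.intervalIntegrable _ _), h0, h1]
  simp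

lemma integral_bump_mul {G g : ℝ → ℝ} (hG : ∀ x, HasDerivAt G (g x) x) (hg : Continuous g) :
    ∫ x in (0 : ℝ)..1, bump x * g x = -∫ x in (0 : ℝ)..1, bump₁ x * G x :=
  integral_mul_deriv_of_zero hasDerivAt_bump (by fun_prop) hG hg (by simp [bump])
    (by norm_num [bump])

lemma integral_bump₁_mul {G g : ℝ → ℝ} (hG : ∀ x, HasDerivAt G (g x) x) (hg : Continuous g) :
    ∫ x in (0 : ℝ)..1, bump₁ x * g x = -∫ x in (0 : ℝ)..1, bump₂ x * G x :=
  integral_mul_deriv_of_zero hasDerivAt_bump₁ (by fun_prop) hG hg (by simp [bump₁])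
    (by norm_num [bump₁])

/-- The triple zeros of `bump` at both ends still make `bump₂` vanish there, so a third derivative
can be moved onto the weight. `bump₃` no longer vanishes at the ends, but no fourth integration by
parts is needed. -/
lemma integral_bump₂_mul {G g : ℝ → ℝ} (hG : ∀ x, HasDerivAt G (g x) x) (hg : Continuous g) :
    ∫ x in (0 : ℝ)..1, bump₂ x * g x = -∫ x in (0 : ℝ)..1, bump₃ x * G x :=
  integral_mul_deriv_of_zero hasDerivAt_bump₂ (by fun_prop) hG hg (by simp [bump₂])
    (by norm_num [bump₂])

/-- A function is controlled by its average against `bump` and its oscillation. -/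
lemma abs_le_of_bump_average {g : ℝ → ℝ} (hg : Continuous g) {x A D : ℝ}
    (hA : |∫ y in (0 : ℝ)..1, bump y * g y| ≤ A)
    (hD : ∀ y ∈ Set.Icc (0 : ℝ) 1, |g x - g y| ≤ D) : |g x| ≤ 140 * A + D := by
  have h1 : ∫ y in (0 : ℝ)..1, bump y * (g x - g y) =
      g x / 140 - ∫ y in (0 : ℝ)..1, bump y * g y := by
    simp only [mul_sub]
    rw [intervalIntegral.integral_sub, intervalIntegral.integral_mul_const, integral_bump]
    · ring
    all_goals exact Continuous.intervalIntegrable (by fun_prop) _ _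
  have h2 : |∫ y in (0 : ℝ)..1, bump y * (g x - g y)| ≤ ∫ y in (0 : ℝ)..1, bump y * D := by
    refine (intervalIntegral.abs_integral_le_integral_abs zero_le_one).trans ?_
    refine intervalIntegral.integral_mono_on zero_le_one
      (Continuous.intervalIntegrable (by fun_prop) _ _)
      (Continuous.intervalIntegrable (by fun_prop) _ _) fun y hy => ?_
    rw [abs_mul, abs_of_nonneg (bump_nonneg hy)]
    exact mul_le_mul_of_nonneg_left (hD y hy) (bump_nonneg hy)
  rw [intervalIntegral.integral_mul_const, integral_bump, h1] at h2
  rw [abs_le] at *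
  constructor <;> linarith [h2.1, h2.2, hA.1, hA.2]

/-! ### Wave profiles and the energy identity -/

/-- The continuous functions attached to a modulated traveling wave and the relations between them
on which the a priori estimate rests: `q` stands for `P_n (u³ - u)`, and `Z` is the `τ`-primitive of
`w - s u - I` with mean zero. -/
structure WaveProfile (s ω I C₀ : ℝ) (u v θ w Z q : ℝ → ℝ → ℝ) : Prop where
  cont_u : Continuous (uncurry u)
  cont_v : Continuous (uncurry v)
  cont_θ : Continuous (uncurry θ)
  cont_w : Continuous (uncurry w)
  cont_Z : Continuous (uncurry Z)
  cont_q : Continuous (uncurry q)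
  u_eq : ∀ x t, HasDerivAt (fun y => u y t) (v x t) x
  v_eq : ∀ x t, HasDerivAt (fun y => v y t) (q x t + θ x t) x
  θ_eq : ∀ x t, HasDerivAt (fun y => θ y t) (w x t) x
  Z_eq : ∀ x t, HasDerivAt (fun y => Z y t) (-ω * (u x t - circInt (u x) / (2 * Real.pi))) x
  Z_primitive : ∀ x t, HasDerivAt (Z x) (w x t - s * u x t - I) t
  Z_periodic : ∀ x, Z x (2 * Real.pi) = Z x 0
  Z_mean : ∀ x, circInt (Z x) = 0
  q_u : ∀ x, circInt (fun t => q x t * u x t) = circInt (fun t => (u x t ^ 3 - u x t) * u x t)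
  q_Z : ∀ x, circInt (fun t => q x t * Z x t) = circInt (fun t => (u x t ^ 3 - u x t) * Z x t)
  q_mean : ∀ x, circInt (q x) = circInt (fun t => u x t ^ 3 - u x t)
  q_primitive : ∀ x, ∀ a ∈ Set.Icc 0 (2 * Real.pi), ∀ b ∈ Set.Icc 0 (2 * Real.pi),
    |∫ t in a..b, q x t| ≤ C₀ * circInt (fun t => |u x t ^ 3 - u x t|)

/-- The energy, which increases in `ξ` up to a bounded drift. -/
noncomputable def waveEnergy (s ω I : ℝ) (u v θ Z : ℝ → ℝ → ℝ) (x : ℝ) : ℝ :=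
  circInt (fun t => u x t * v x t) + I / s * circInt (v x)
    - circInt (θ x) ^ 2 / (2 * s * (2 * Real.pi)) + circInt (fun t => θ x t * Z x t) / ω
    + s / (2 * ω ^ 2) * circInt (fun t => Z x t ^ 2)

namespace WaveProfile

variable {s ω I C₀ : ℝ} {u v θ w Z q : ℝ → ℝ → ℝ}

lemma shift (h : WaveProfile s ω I C₀ u v θ w Z q) (a : ℝ) :
    WaveProfile s ω I C₀ (fun x => u (x + a)) (fun x => v (x + a)) (fun x => θ (x + a))
      (fun x => w (x + a)) (fun x => Z (x + a)) (fun x => q (x + a)) := by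
  obtain ⟨_, _, _, _, _, _, h1, h2, h3, h4, _, _, _, _, _, _, _⟩ := h
  constructor <;> intros
  all_goals first
    | fun_prop
    | exact (h1 _ _).comp_add_const _ _
    | exact (h2 _ _).comp_add_const _ _
    | exact (h3 _ _).comp_add_const _ _
    | exact (h4 _ _).comp_add_const _ _
    | solve_by_elim

lemma shift_energy (s ω I : ℝ) (u v θ Z : ℝ → ℝ → ℝ) (a x : ℝ) :
    waveEnergy s ω I (fun x => u (x + a)) (fun x => v (x + a)) (fun x => θ (x + a))
      (fun x => Z (x + a)) x = waveEnergy s ω I u v θ Z (x + a) := rfl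

lemma hasDerivAt_circInt_u (h : WaveProfile s ω I C₀ u v θ w Z q) (x : ℝ) :
    HasDerivAt (fun y => circInt (u y)) (circInt (v x)) x := by
  have := h.cont_u
  exact hasDerivAt_circInt (fun x => by fun_prop) h.cont_v h.u_eq x

/-- Periodicity of `Z` says that w - su - I has zero mean on every period. -/
lemma circInt_w (h : WaveProfile s ω I C₀ u v θ w Z q) (x : ℝ) :
    circInt (w x) = 2 * Real.pi * I + s * circInt (u x) := by
  have hu := h.cont_u
  have hw := h.cont_w
  have h1 : circInt (fun t => w x t - s * u x t - I) = Z x (2 * Real.pi) - Z x 0 :=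
    intervalIntegral.integral_eq_sub_of_hasDerivAt (fun t _ => h.Z_primitive x t)
      (Continuous.intervalIntegrable (by fun_prop) _ _)
  rw [circInt_sub (by fun_prop) (by fun_prop), circInt_sub (by fun_prop) (by fun_prop),
    circInt_const_mul, circInt_const, h.Z_periodic] at h1
  linarith

lemma hasDerivAt_circInt_θ (h : WaveProfile s ω I C₀ u v θ w Z q) (x : ℝ) :
    HasDerivAt (fun y => circInt (θ y)) (2 * Real.pi * I + s * circInt (u x)) x := by
  have := h.cont_θ
  rw [← h.circInt_w]
  exact hasDerivAt_circInt (fun x => by fun_prop) h.cont_w h.θ_eq x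

/-- The integral of Z Z_τ over a period vanishes, and the constant I pairs to zero with the
mean-zero `Z`. -/
lemma circInt_w_mul_Z (h : WaveProfile s ω I C₀ u v θ w Z q) (x : ℝ) :
    circInt (fun t => w x t * Z x t) = s * circInt (fun t => u x t * Z x t) := by
  have hu := h.cont_u
  have hw := h.cont_w
  have hZ := h.cont_Z
  have h1 : circInt (fun t => 2 * Z x t * (w x t - s * u x t - I)) =
      Z x (2 * Real.pi) ^ 2 - Z x 0 ^ 2 := by
    refine intervalIntegral.integral_eq_sub_of_hasDerivAt (f := fun t => Z x t ^ 2) (fun t _ => ?_)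
      (Continuous.intervalIntegrable (by fun_prop) _ _)
    exact ((h.Z_primitive x t).pow 2).congr_deriv (by norm_num)
  have h2 : ∀ t, 2 * Z x t * (w x t - s * u x t - I) =
      2 * (w x t * Z x t) - 2 * s * (u x t * Z x t) - 2 * I * Z x t := fun t => by ring
  simp only [h2] at h1
  rw [circInt_sub (by fun_prop) (by fun_prop), circInt_sub (by fun_prop) (by fun_prop),
    circInt_const_mul, circInt_const_mul, circInt_const_mul, h.Z_mean, h.Z_periodic] at h1
  linarith

/-- Each correction in the energy removes one bad term. The integral of uθ from (uv)_ξ is cancelled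
by θZ_ξ/ω up to a product of means; the square of the mean of θ absorbs that product together with
(I/s) times the integral of θ; and the Z² term cancels θ_ξ Z/ω = wZ/ω, which integrates to (s/ω)
times the integral of uZ. In the pairing with u and in the mean, the profile relations replace `q`
by u³ - u. -/
lemma hasDerivAt_energy (hs : s ≠ 0) (hω : ω ≠ 0) (h : WaveProfile s ω I C₀ u v θ w Z q) (x : ℝ) :
    HasDerivAt (waveEnergy s ω I u v θ Z)
      (circInt (fun t => v x t ^ 2 + (u x t ^ 3 - u x t) * (u x t + I / s))) x := by
  have hu := h.cont_u
  have hv := h.cont_v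
  have hθ := h.cont_θ
  have hw := h.cont_w
  have hZ := h.cont_Z
  have hq := h.cont_q
  have hU : Continuous fun p : ℝ × ℝ => circInt (u p.1) :=
    (continuous_circInt hu).comp continuous_fst
  obtain ⟨Z', hZ', cZ'⟩ : ∃ Z' : ℝ → ℝ → ℝ, (∀ x t, Z' x t =
      -ω * (u x t - circInt (u x) / (2 * Real.pi))) ∧ Continuous (uncurry Z') :=
    ⟨_, fun _ _ => rfl, continuous_const.mul (hu.sub (hU.div_const _))⟩
  have dZ : ∀ x t, HasDerivAt (fun y => Z y t) (Z' x t) x := fun x t => by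
    rw [hZ']; exact h.Z_eq x t
  have d1 := hasDerivAt_circInt (F := fun x t => u x t * v x t) (fun x => by fun_prop)
    (by fun_prop) (fun x t => (h.u_eq x t).mul (h.v_eq x t)) x
  have d2 := hasDerivAt_circInt (F := v) (fun x => by fun_prop)
    (F' := fun x t => q x t + θ x t) (by fun_prop) h.v_eq x
  have d3 := h.hasDerivAt_circInt_θ x
  have d4 := hasDerivAt_circInt (F := fun x t => θ x t * Z x t) (fun x => by fun_prop)
    (by fun_prop) (fun x t => (h.θ_eq x t).mul (dZ x t)) x
  have d5 := hasDerivAt_circInt (F := fun x t => Z x t ^ 2) (fun x => by fun_prop)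
    (by fun_prop) (fun x t => (dZ x t).pow 2) x
  have d := (((d1.add (d2.const_mul (I / s))).sub ((d3.pow 2).div_const
    (2 * s * (2 * Real.pi)))).add (d4.div_const ω)).add (d5.const_mul (s / (2 * ω ^ 2)))
  refine d.congr_deriv ?_
  have e1 : circInt (fun t => v x t * v x t + u x t * (q x t + θ x t)) =
      circInt (fun t => v x t ^ 2) + circInt (fun t => (u x t ^ 3 - u x t) * u x t)
        + circInt (fun t => u x t * θ x t) := by
    rw [← h.q_u, ← circInt_add (by fun_prop) (by fun_prop),
      ← circInt_add (by fun_prop) (by fun_prop)]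
    congr 1; ext t; ring
  have e2 : circInt (fun t => q x t + θ x t) =
      circInt (fun t => u x t ^ 3 - u x t) + circInt (θ x) := by
    rw [← h.q_mean, ← circInt_add (by fun_prop) (by fun_prop)]
  have e4 : circInt (fun t => w x t * Z x t +
        θ x t * (-ω * (u x t - circInt (u x) / (2 * Real.pi)))) =
      s * circInt (fun t => u x t * Z x t) - ω * circInt (fun t => u x t * θ x t)
        + ω * (circInt (u x) / (2 * Real.pi)) * circInt (θ x) := by
    rw [← h.circInt_w_mul_Z, ← circInt_const_mul, ← circInt_const_mul,
      ← circInt_sub (by fun_prop) (by fun_prop), ← circInt_add (by fun_prop) (by fun_prop)]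
    congr 1; ext t; ring
  have e5 : circInt (fun t => ((2 : ℕ) : ℝ) * Z x t ^ (2 - 1) *
        (-ω * (u x t - circInt (u x) / (2 * Real.pi)))) =
      -2 * ω * circInt (fun t => u x t * Z x t) := by
    have : ∀ t, ((2 : ℕ) : ℝ) * Z x t ^ (2 - 1) *
        (-ω * (u x t - circInt (u x) / (2 * Real.pi))) =
        -2 * ω * (u x t * Z x t) + 2 * ω * (circInt (u x) / (2 * Real.pi)) * Z x t := by
      intro t; norm_num; ring
    simp only [this]
    rw [circInt_add (by fun_prop) (by fun_prop), circInt_const_mul, circInt_const_mul, h.Z_mean]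
    ring
  have e6 : circInt (fun t => v x t ^ 2 + (u x t ^ 3 - u x t) * (u x t + I / s)) =
      circInt (fun t => v x t ^ 2) + circInt (fun t => (u x t ^ 3 - u x t) * u x t)
        + I / s * circInt (fun t => u x t ^ 3 - u x t) := by
    rw [← circInt_const_mul, ← circInt_add (by fun_prop) (by fun_prop),
      ← circInt_add (by fun_prop) (by fun_prop)]
    congr 1; ext t; ring
  simp only [hZ']
  rw [e1, e2, e4, e5, e6]
  have hpi := Real.pi_pos.ne'
  push_cast
  field_simp
  ring

end WaveProfile

/-- Young's inequality: the cubic, quadratic and linear terms are absorbed into half of r⁴. The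
constant 10 is not optimal. -/
lemma quartic_lower_bound (k r : ℝ) :
    r ^ 4 / 2 - (10 * (1 + k ^ 2) ^ 2) ≤ (r ^ 3 - r) * (r + k) := by
  nlinarith [sq_nonneg (r ^ 2 / 4 + 2 * k * r), sq_nonneg (r ^ 2 / 4 - 2 * (1 + 4 * k ^ 2)),
    sq_nonneg (r - k), sq_nonneg (r ^ 2 / 2 + k * r), sq_nonneg (r ^ 2 / 4 - 4 * k ^ 2),
    sq_nonneg (r ^ 2 - 4), sq_nonneg k, sq_nonneg (k^2), sq_nonneg (r ^ 2 / 2 - (1 + k ^ 2) * 3)]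

namespace WaveProfile

variable {s ω I C₀ : ℝ} {u v θ w Z q : ℝ → ℝ → ℝ}

/-- The energy increases along the wave, up to a drift, by at least the local `L⁴` mass. -/
lemma energy_sub_ge (hs : s ≠ 0) (hω : ω ≠ 0) (h : WaveProfile s ω I C₀ u v θ w Z q) {a b : ℝ}
    (hab : a ≤ b) :
    (∫ x in a..b, circInt (fun t => u x t ^ 4)) / 2
        - (b - a) * (2 * Real.pi * (10 * (1 + (I / s) ^ 2) ^ 2)) ≤
      waveEnergy s ω I u v θ Z b - waveEnergy s ω I u v θ Z a := by
  have hu := h.cont_u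
  have hv := h.cont_v
  have c1 : Continuous fun x =>
      circInt (fun t => v x t ^ 2 + (u x t ^ 3 - u x t) * (u x t + I / s)) :=
    continuous_circInt (by fun_prop)
  have c2 : Continuous fun x => circInt (fun t => u x t ^ 4) := continuous_circInt (by fun_prop)
  rw [← intervalIntegral.integral_eq_sub_of_hasDerivAt
    (fun x _ => h.hasDerivAt_energy hs hω x) (c1.intervalIntegrable _ _)]
  have e : (∫ x in a..b, circInt (fun t => u x t ^ 4)) / 2
        - (b - a) * (2 * Real.pi * (10 * (1 + (I / s) ^ 2) ^ 2)) =
      ∫ x in a..b, (circInt (fun t => u x t ^ 4) / 2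
        - 2 * Real.pi * (10 * (1 + (I / s) ^ 2) ^ 2)) := by
    rw [intervalIntegral.integral_sub, intervalIntegral.integral_div]
    · simp; ring
    all_goals exact Continuous.intervalIntegrable (by fun_prop) _ _
  rw [e]
  refine intervalIntegral.integral_mono hab (Continuous.intervalIntegrable (by fun_prop) _ _)
    (c1.intervalIntegrable _ _) fun x => ?_
  have e2 : circInt (fun t => u x t ^ 4) / 2 - 2 * Real.pi * (10 * (1 + (I / s) ^ 2) ^ 2) =
      circInt (fun t => (1 / 2) * u x t ^ 4 - 10 * (1 + (I / s) ^ 2) ^ 2) := by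
    rw [circInt_sub (by fun_prop) (by fun_prop), circInt_const_mul, circInt_const]
    ring
  simp only [e2]
  refine circInt_mono (by fun_prop) (by fun_prop) fun t => ?_
  have := quartic_lower_bound (I / s) (u x t)
  nlinarith [sq_nonneg (v x t)]

end WaveProfile

/-! ### Control of the averaged energy by the local L⁴ mass -/

lemma abs_integral_unit_le {g m : ℝ → ℝ} (hg : Continuous g) (hm : Continuous m)
    {c₁ c₂ N : ℝ} (hc : 0 ≤ c₂) (hN : ∫ x in (0 : ℝ)..1, m x ≤ N)
    (h : ∀ x ∈ Set.Icc (0 : ℝ) 1, |g x| ≤ c₁ + c₂ * m x) :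
    |∫ x in (0 : ℝ)..1, g x| ≤ c₁ + c₂ * N := by
  refine (intervalIntegral.abs_integral_le_integral_abs zero_le_one).trans ?_
  refine (intervalIntegral.integral_mono_on zero_le_one (hg.abs.intervalIntegrable _ _)
    (Continuous.intervalIntegrable (by fun_prop) _ _) h).trans ?_
  rw [intervalIntegral.integral_add, intervalIntegral.integral_const_mul]
  · simpa using mul_le_mul_of_nonneg_left hN hc
  all_goals exact Continuous.intervalIntegrable (by fun_prop) _ _

lemma abs_le_one_add_pow_four (r : ℝ) : |r| ≤ 1 + r ^ 4 := by
  rw [abs_le]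
  constructor <;> nlinarith [sq_nonneg (r ^ 2 - 1), sq_nonneg (r - 1), sq_nonneg (r + 1)]

lemma abs_cube_sub_le (r : ℝ) : |r ^ 3 - r| ≤ 2 * (1 + r ^ 4) := by
  rw [abs_le]
  constructor <;> nlinarith [sq_nonneg (r ^ 2 - r), sq_nonneg (r ^ 2 + r), sq_nonneg (r ^ 2 - 1),
    sq_nonneg (r - 1), sq_nonneg (r + 1)]

lemma abs_mul_le_one_add (r z : ℝ) : |r * z| ≤ 1 + r ^ 4 + z ^ 4 := by
  rw [abs_le]
  constructor <;> nlinarith [sq_nonneg (r ^ 2 - 1), sq_nonneg (z ^ 2 - 1), sq_nonneg (r - z),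
    sq_nonneg (r + z)]

lemma abs_cube_mul_le (r z : ℝ) : |r ^ 3 * z| ≤ r ^ 4 + z ^ 4 := by
  rw [abs_le]
  constructor <;> nlinarith [sq_nonneg (r ^ 2 - z ^ 2), sq_nonneg (r ^ 2 - r * z),
    sq_nonneg (r ^ 2 + r * z), sq_nonneg (r * z), sq_nonneg (z ^ 2)]

lemma abs_cube_sub_mul_le (r z : ℝ) : |(r ^ 3 - r) * z| ≤ 2 * (1 + r ^ 4 + z ^ 4) := by
  have h1 := abs_cube_mul_le r z
  have h2 := abs_mul_le_one_add r z
  have h3 : (r ^ 3 - r) * z = r ^ 3 * z - r * z := by ring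
  rw [h3]
  exact (abs_sub _ _).trans (by linarith)

namespace WaveProfile

variable {s ω I C₀ : ℝ} {u v θ w Z q : ℝ → ℝ → ℝ}

/-- The point is that no v and no product θZ survive on the right. The terms uv, θZ/ω and (I/s)v
form an exact ξ-derivative up to (u³ - u)Z/ω; one integration by parts leaves vZ/ω, which is itself
the ξ-derivative of uZ/ω up to the variance of u, so a second one removes it. -/
lemma integral_bump_mul_energy (hs : s ≠ 0) (hω : ω ≠ 0) (h : WaveProfile s ω I C₀ u v θ w Z q) :
    ∫ x in (0 : ℝ)..1, bump x * waveEnergy s ω I u v θ Z x =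
      ∫ x in (0 : ℝ)..1, (bump₂ x * (circInt (fun t => u x t * Z x t) / ω)
        - bump₁ x * (3 / 2 * (circInt (fun t => u x t ^ 2) - circInt (u x) ^ 2 / (2 * Real.pi))
            + circInt (fun t => u x t ^ 2) / 2 + I / s * circInt (u x))
        + bump x * (-(circInt (θ x) ^ 2 / (2 * s * (2 * Real.pi)))
            + s / (2 * ω ^ 2) * circInt (fun t => Z x t ^ 2)
            - circInt (fun t => (u x t ^ 3 - u x t) * Z x t) / ω)) := by
  have hu := h.cont_u
  have hv := h.cont_v
  have hθ := h.cont_θ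
  have hw := h.cont_w
  have hZ := h.cont_Z
  have hq := h.cont_q
  have hpi := Real.pi_pos.ne'
  have cU : Continuous fun x => circInt (u x) := continuous_circInt hu
  have cV : Continuous fun x => circInt (v x) := continuous_circInt hv
  have cθ : Continuous fun x => circInt (θ x) := continuous_circInt hθ
  have cu2 : Continuous fun x => circInt (fun t => u x t ^ 2) := continuous_circInt (by fun_prop)
  have cuv : Continuous fun x => circInt (fun t => u x t * v x t) := continuous_circInt (by fun_prop)
  have cuZ : Continuous fun x => circInt (fun t => u x t * Z x t) := continuous_circInt (by fun_prop)
  have cvZ : Continuous fun x => circInt (fun t => v x t * Z x t) := continuous_circInt (by fun_prop)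
  have cθZ : Continuous fun x => circInt (fun t => θ x t * Z x t) := continuous_circInt (by fun_prop)
  have cZ2 : Continuous fun x => circInt (fun t => Z x t ^ 2) := continuous_circInt (by fun_prop)
  have cfZ : Continuous fun x => circInt (fun t => (u x t ^ 3 - u x t) * Z x t) :=
    continuous_circInt (by fun_prop)
  have hU : Continuous fun p : ℝ × ℝ => circInt (u p.1) := cU.comp continuous_fst
  obtain ⟨Z', hZ', cZ'⟩ : ∃ Z' : ℝ → ℝ → ℝ, (∀ x t, Z' x t =
      -ω * (u x t - circInt (u x) / (2 * Real.pi))) ∧ Continuous (uncurry Z') :=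
    ⟨_, fun _ _ => rfl, continuous_const.mul (hu.sub (hU.div_const _))⟩
  have dZ : ∀ x t, HasDerivAt (fun y => Z y t) (Z' x t) x := fun x t => by
    rw [hZ']; exact h.Z_eq x t
  have du := h.hasDerivAt_circInt_u
  have du2 := hasDerivAt_circInt (F := fun x t => u x t ^ 2) (fun x => by fun_prop)
    (by fun_prop) (fun x t => (h.u_eq x t).pow 2)
  have duZ := hasDerivAt_circInt (F := fun x t => u x t * Z x t) (fun x => by fun_prop)
    (by fun_prop) (fun x t => (h.u_eq x t).mul (dZ x t))
  have dvZ := hasDerivAt_circInt (F := fun x t => v x t * Z x t) (fun x => by fun_prop)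
    (by fun_prop) (fun x t => (h.v_eq x t).mul (dZ x t))
  have e_u2 : ∀ x, circInt (fun t => ((2 : ℕ) : ℝ) * u x t ^ (2 - 1) * v x t) =
      2 * circInt (fun t => u x t * v x t) := by
    intro x
    rw [← circInt_const_mul]
    congr 1; ext t; norm_num; ring
  have e_uZ : ∀ x, circInt (fun t => v x t * Z x t +
        u x t * (-ω * (u x t - circInt (u x) / (2 * Real.pi)))) =
      circInt (fun t => v x t * Z x t)
        - ω * (circInt (fun t => u x t ^ 2) - circInt (u x) ^ 2 / (2 * Real.pi)) := by
    intro x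
    have : ∀ t, v x t * Z x t + u x t * (-ω * (u x t - circInt (u x) / (2 * Real.pi))) =
        v x t * Z x t - ω * u x t ^ 2 + ω * (circInt (u x) / (2 * Real.pi)) * u x t := by
      intro t; ring
    simp only [this]
    rw [circInt_add (by fun_prop) (by fun_prop), circInt_sub (by fun_prop) (by fun_prop),
      circInt_const_mul, circInt_const_mul]
    ring
  have e_vZ : ∀ x, circInt (fun t => (q x t + θ x t) * Z x t +
        v x t * (-ω * (u x t - circInt (u x) / (2 * Real.pi)))) =
      circInt (fun t => (u x t ^ 3 - u x t) * Z x t) + circInt (fun t => θ x t * Z x t)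
        - ω * (circInt (fun t => u x t * v x t) - circInt (u x) * circInt (v x) / (2 * Real.pi)) := by
    intro x
    have : ∀ t, (q x t + θ x t) * Z x t +
        v x t * (-ω * (u x t - circInt (u x) / (2 * Real.pi))) =
        q x t * Z x t + θ x t * Z x t - ω * (u x t * v x t)
          + ω * (circInt (u x) / (2 * Real.pi)) * v x t := by
      intro t; ring
    simp only [this]
    rw [circInt_add (by fun_prop) (by fun_prop), circInt_sub (by fun_prop) (by fun_prop),
      circInt_add (by fun_prop) (by fun_prop), circInt_const_mul, circInt_const_mul, h.q_Z]
    ring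
  simp only [e_u2] at du2
  simp only [hZ', e_uZ] at duZ
  simp only [hZ', e_vZ] at dvZ
  -- The term vZ_ξ/ω contributes minus the covariance of u and v. Half the variance of u has exactly
  -- that covariance as derivative and cancels it; the further u²/2 then supplies uv.
  have dA : ∀ x, HasDerivAt (fun x => circInt (fun t => v x t * Z x t) / ω
      + (circInt (fun t => u x t ^ 2) - circInt (u x) ^ 2 / (2 * Real.pi)) / 2
      + circInt (fun t => u x t ^ 2) / 2 + I / s * circInt (u x))
      (circInt (fun t => (u x t ^ 3 - u x t) * Z x t) / ω
        + circInt (fun t => θ x t * Z x t) / ω + circInt (fun t => u x t * v x t)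
        + I / s * circInt (v x)) x := by
    intro x
    refine (((((dvZ x).div_const ω).add (((du2 x).sub
      (((du x).pow 2).div_const (2 * Real.pi))).div_const 2)).add
      ((du2 x).div_const 2)).add ((du x).const_mul (I / s))).congr_deriv ?_
    push_cast
    field_simp
    ring
  have dB : ∀ x, HasDerivAt (fun x => circInt (fun t => u x t * Z x t) / ω)
      (circInt (fun t => v x t * Z x t) / ω
        - (circInt (fun t => u x t ^ 2) - circInt (u x) ^ 2 / (2 * Real.pi))) x := by
    intro x
    refine ((duZ x).div_const ω).congr_deriv ?_
    field_simp
  have iA := integral_bump_mul dA (by fun_prop)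
  have iB := integral_bump₁_mul dB (by fun_prop)
  have s1 : ∫ x in (0 : ℝ)..1, bump x * waveEnergy s ω I u v θ Z x =
      (∫ x in (0 : ℝ)..1, bump x * (circInt (fun t => (u x t ^ 3 - u x t) * Z x t) / ω
        + circInt (fun t => θ x t * Z x t) / ω + circInt (fun t => u x t * v x t)
        + I / s * circInt (v x))) +
      ∫ x in (0 : ℝ)..1, bump x * (-(circInt (θ x) ^ 2 / (2 * s * (2 * Real.pi)))
            + s / (2 * ω ^ 2) * circInt (fun t => Z x t ^ 2)
            - circInt (fun t => (u x t ^ 3 - u x t) * Z x t) / ω) := by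
    rw [← intervalIntegral.integral_add (Continuous.intervalIntegrable (by fun_prop) _ _)
      (Continuous.intervalIntegrable (by fun_prop) _ _)]
    congr 1; ext x
    simp only [waveEnergy]
    ring
  have s2 : ∫ x in (0 : ℝ)..1, bump₁ x * (circInt (fun t => v x t * Z x t) / ω
      + (circInt (fun t => u x t ^ 2) - circInt (u x) ^ 2 / (2 * Real.pi)) / 2
      + circInt (fun t => u x t ^ 2) / 2 + I / s * circInt (u x)) =
      (∫ x in (0 : ℝ)..1, bump₁ x * (circInt (fun t => v x t * Z x t) / ω
        - (circInt (fun t => u x t ^ 2) - circInt (u x) ^ 2 / (2 * Real.pi)))) +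
      ∫ x in (0 : ℝ)..1, bump₁ x *
        (3 / 2 * (circInt (fun t => u x t ^ 2) - circInt (u x) ^ 2 / (2 * Real.pi))
            + circInt (fun t => u x t ^ 2) / 2 + I / s * circInt (u x)) := by
    rw [← intervalIntegral.integral_add (Continuous.intervalIntegrable (by fun_prop) _ _)
      (Continuous.intervalIntegrable (by fun_prop) _ _)]
    congr 1; ext x
    ring
  rw [s1, iA, s2, iB, intervalIntegral.integral_add, intervalIntegral.integral_sub]
  · ring
  all_goals exact Continuous.intervalIntegrable (by fun_prop) _ _

section LocalBounds

variable {N : ℝ}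

/-- The mean of θ is the mean of v_ξ minus that of u³ - u, so its weighted average is bounded after
two integrations by parts. Its oscillation on the unit interval is bounded because its derivative is
affine in the mean of u. -/
lemma abs_circInt_θ_le (h : WaveProfile s ω I C₀ u v θ w Z q)
    (hN : ∫ x in (0 : ℝ)..1, circInt (fun t => u x t ^ 4) ≤ N) {x : ℝ}
    (hx : x ∈ Set.Icc (0 : ℝ) 1) :
    |circInt (θ x)| ≤ 140 * (378 * 3 * (2 * Real.pi) + 378 * 3 * N)
      + ((2 * Real.pi * |I| + |s| * (2 * Real.pi)) + |s| * N) := by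
  have hu := h.cont_u
  have hv := h.cont_v
  have hθ := h.cont_θ
  have hq := h.cont_q
  have cU : Continuous fun x => circInt (u x) := continuous_circInt hu
  have cV : Continuous fun x => circInt (v x) := continuous_circInt hv
  have cθ : Continuous fun x => circInt (θ x) := continuous_circInt hθ
  have cf : Continuous fun x => circInt (fun t => u x t ^ 3 - u x t) :=
    continuous_circInt (by fun_prop)
  have cm : Continuous fun x => circInt (fun t => u x t ^ 4) := continuous_circInt (by fun_prop)
  have bu : ∀ x, |circInt (u x)| ≤ 2 * Real.pi + circInt (fun t => u x t ^ 4) := by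
    intro x
    refine (abs_circInt_le (by fun_prop) (by fun_prop)
      fun t => abs_le_one_add_pow_four (u x t)).trans_eq ?_
    rw [circInt_add (by fun_prop) (by fun_prop), circInt_const, mul_one]
  have bf : ∀ x, |circInt (fun t => u x t ^ 3 - u x t)| ≤
      2 * (2 * Real.pi + circInt (fun t => u x t ^ 4)) := by
    intro x
    refine (abs_circInt_le (by fun_prop) (by fun_prop)
      fun t => abs_cube_sub_le (u x t)).trans_eq ?_
    rw [circInt_const_mul, circInt_add (by fun_prop) (by fun_prop), circInt_const, mul_one]
  have dV : ∀ x, HasDerivAt (fun y => circInt (v y))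
      (circInt (fun t => u x t ^ 3 - u x t) + circInt (θ x)) x := by
    intro x
    rw [← h.q_mean, ← circInt_add (by fun_prop) (by fun_prop)]
    exact hasDerivAt_circInt (fun x => by fun_prop) (by fun_prop) h.v_eq x
  have iV := integral_bump_mul dV (by fun_prop)
  have iU := integral_bump₁_mul h.hasDerivAt_circInt_u cV
  have key : ∫ y in (0 : ℝ)..1, bump y * circInt (θ y) =
      ∫ y in (0 : ℝ)..1, (bump₂ y * circInt (u y)
        - bump y * circInt (fun t => u y t ^ 3 - u y t)) := by
    simp only [mul_add] at iV
    rw [intervalIntegral.integral_add] at iV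
    · rw [intervalIntegral.integral_sub]
      · linarith
      all_goals exact Continuous.intervalIntegrable (by fun_prop) _ _
    all_goals exact Continuous.intervalIntegrable (by fun_prop) _ _
  refine abs_le_of_bump_average (g := fun x => circInt (θ x)) cθ ?_ fun y hy => ?_
  · rw [key]
    refine abs_integral_unit_le (by fun_prop) cm (by norm_num) hN fun y hy => ?_
    obtain ⟨b0, -, b2, -⟩ := abs_bump_le hy
    refine (abs_sub _ _).trans ?_
    rw [abs_mul, abs_mul]
    have := mul_le_mul b2 (bu y) (abs_nonneg _) (by norm_num)
    have := mul_le_mul b0 (bf y) (abs_nonneg _) (by norm_num)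
    linarith
  · rw [← intervalIntegral.integral_eq_sub_of_hasDerivAt
      (fun x _ => h.hasDerivAt_circInt_θ x) (Continuous.intervalIntegrable (by fun_prop) _ _)]
    refine (abs_integral_le_of_mem_Icc (by fun_prop) (g := fun x => (2 * Real.pi * |I| +
      |s| * (2 * Real.pi)) + |s| * circInt (fun t => u x t ^ 4)) (by fun_prop)
      (fun x => ?_) hy hx).trans ?_
    · refine (abs_add_le _ _).trans ?_
      rw [abs_mul (2 * Real.pi), abs_mul s, abs_of_pos Real.two_pi_pos]
      have := mul_le_mul_of_nonneg_left (bu x) (abs_nonneg s)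
      linarith
    · rw [intervalIntegral.integral_add, intervalIntegral.integral_const_mul]
      · simpa using mul_le_mul_of_nonneg_left hN (abs_nonneg s)
      all_goals exact Continuous.intervalIntegrable (by fun_prop) _ _

/-- Differences of `Z` in τ are integrals of w - su - I over [a, b], and w = u_ξξξ - q_ξ. Moving all
ξ-derivatives onto the weight leaves only τ-integrals of u and q; for q this uses the bound on
primitives, which is why `Z` rather than w appears in the energy estimates. -/
lemma abs_bump_average_Z_sub_le (hC₀ : 0 ≤ C₀) (h : WaveProfile s ω I C₀ u v θ w Z q)
    (hN : ∫ x in (0 : ℝ)..1, circInt (fun t => u x t ^ 4) ≤ N) {a b : ℝ}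
    (ha : a ∈ Set.Icc 0 (2 * Real.pi)) (hb : b ∈ Set.Icc 0 (2 * Real.pi)) :
    |∫ y in (0 : ℝ)..1, bump y * (Z y b - Z y a)| ≤
      378 * (1 + 2 * C₀ + |s| + |I|) * (2 * Real.pi)
        + 378 * (1 + 2 * C₀ + |s| + |I|) * N := by
  have hu := h.cont_u
  have hv := h.cont_v
  have hθ := h.cont_θ
  have hw := h.cont_w
  have hZ := h.cont_Z
  have hq := h.cont_q
  have cm : Continuous fun x => circInt (fun t => u x t ^ 4) := continuous_circInt (by fun_prop)
  have cint : ∀ F : ℝ → ℝ → ℝ, Continuous (uncurry F) → Continuous fun y => ∫ t in a..b, F y t :=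
    fun F hF => intervalIntegral.continuous_parametric_intervalIntegral_of_continuous' hF _ _
  have cu := cint u hu
  have cv := cint v hv
  have cθ := cint θ hθ
  have cw := cint w hw
  have cq := cint q hq
  have du : ∀ x, HasDerivAt (fun y => ∫ t in a..b, u y t) (∫ t in a..b, v x t) x :=
    hasDerivAt_integral_of_continuous (fun x => by fun_prop) hv h.u_eq a b
  have dv : ∀ x, HasDerivAt (fun y => ∫ t in a..b, v y t)
      ((∫ t in a..b, q x t) + ∫ t in a..b, θ x t) x := by
    intro x
    rw [← intervalIntegral.integral_add (Continuous.intervalIntegrable (by fun_prop) _ _)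
      (Continuous.intervalIntegrable (by fun_prop) _ _)]
    exact hasDerivAt_integral_of_continuous (fun x => by fun_prop) (by fun_prop) h.v_eq a b x
  have dθ : ∀ x, HasDerivAt (fun y => ∫ t in a..b, θ y t) (∫ t in a..b, w x t) x :=
    hasDerivAt_integral_of_continuous (fun x => by fun_prop) hw h.θ_eq a b
  have iu := integral_bump₂_mul du cv
  have iv := integral_bump₁_mul dv (by fun_prop)
  have iθ := integral_bump_mul dθ cw
  have eZ : ∀ y, Z y b - Z y a =
      (∫ t in a..b, w y t) - s * (∫ t in a..b, u y t) - I * (b - a) := by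
    intro y
    rw [← intervalIntegral.integral_eq_sub_of_hasDerivAt (fun t _ => h.Z_primitive y t)
      (Continuous.intervalIntegrable (by fun_prop) _ _), intervalIntegral.integral_sub,
      intervalIntegral.integral_sub, intervalIntegral.integral_const_mul]
    · simp; ring
    all_goals exact Continuous.intervalIntegrable (by fun_prop) _ _
  have key : ∫ y in (0 : ℝ)..1, bump y * (Z y b - Z y a) =
      ∫ y in (0 : ℝ)..1, (bump₁ y * (∫ t in a..b, q y t) - bump₃ y * (∫ t in a..b, u y t)
        - bump y * (s * (∫ t in a..b, u y t) + I * (b - a))) := by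
    simp only [mul_add (bump₁ _)] at iv
    rw [intervalIntegral.integral_add (Continuous.intervalIntegrable (by fun_prop) _ _)
      (Continuous.intervalIntegrable (by fun_prop) _ _)] at iv
    have : ∀ y, bump y * (Z y b - Z y a) = bump y * (∫ t in a..b, w y t)
        - bump y * (s * (∫ t in a..b, u y t) + I * (b - a)) := by
      intro y; rw [eZ]; ring
    simp only [this]
    rw [intervalIntegral.integral_sub, intervalIntegral.integral_sub,
      intervalIntegral.integral_sub]
    · linarith
    all_goals exact Continuous.intervalIntegrable (by fun_prop) _ _
  rw [key]
  refine abs_integral_unit_le (by fun_prop) cm (by positivity) hN fun y hy => ?_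
  obtain ⟨b0, b1, -, b3⟩ := abs_bump_le hy
  have hm : 0 ≤ circInt (fun t => u y t ^ 4) :=
    intervalIntegral.integral_nonneg (by positivity) fun t _ => by positivity
  set m := circInt (fun t => u y t ^ 4)
  have bu : |∫ t in a..b, u y t| ≤ 2 * Real.pi + m := by
    refine (abs_integral_le_of_mem_Icc (by fun_prop) (by fun_prop)
      (fun t => abs_le_one_add_pow_four (u y t)) ha hb).trans_eq ?_
    exact (circInt_add (by fun_prop) (by fun_prop)).trans (by rw [circInt_const, mul_one])
  have bq : |∫ t in a..b, q y t| ≤ C₀ * (2 * (2 * Real.pi + m)) := by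
    refine (h.q_primitive y a ha b hb).trans (mul_le_mul_of_nonneg_left ?_ hC₀)
    refine (circInt_mono (by fun_prop) (by fun_prop)
      fun t => abs_cube_sub_le (u y t)).trans_eq ?_
    rw [circInt_const_mul, circInt_add (by fun_prop) (by fun_prop), circInt_const, mul_one]
  have bI : |s * (∫ t in a..b, u y t) + I * (b - a)| ≤ (|s| + |I|) * (2 * Real.pi + m) := by
    refine (abs_add_le _ _).trans ?_
    rw [abs_mul, abs_mul, add_mul]
    have hab : |b - a| ≤ 2 * Real.pi + m := by
      rw [abs_le]; constructor <;> linarith [ha.1, ha.2, hb.1, hb.2]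
    gcongr
  refine (abs_sub _ _).trans ((add_le_add_left (abs_sub _ _) _).trans ?_)
  rw [abs_mul, abs_mul, abs_mul]
  have := mul_le_mul b1 bq (abs_nonneg _) (by norm_num)
  have := mul_le_mul b3 bu (abs_nonneg _) (by norm_num)
  have := mul_le_mul b0 bI (abs_nonneg _) (by norm_num)
  linarith

/-- Averaging the difference bound over the base point a removes `Z y a`, since `Z` has mean zero in
τ. -/
lemma abs_bump_average_Z_le (hC₀ : 0 ≤ C₀) (h : WaveProfile s ω I C₀ u v θ w Z q)
    (hN : ∫ x in (0 : ℝ)..1, circInt (fun t => u x t ^ 4) ≤ N) {b : ℝ}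
    (hb : b ∈ Set.Icc 0 (2 * Real.pi)) :
    |∫ y in (0 : ℝ)..1, bump y * Z y b| ≤
      378 * (1 + 2 * C₀ + |s| + |I|) * (2 * Real.pi)
        + 378 * (1 + 2 * C₀ + |s| + |I|) * N := by
  have hZ := h.cont_Z
  have hswap : circInt (fun a => ∫ y in (0 : ℝ)..1, bump y * Z y a) = 0 := by
    unfold circInt
    rw [MeasureTheory.intervalIntegral_intervalIntegral_swap]
    · have : ∀ y, ∫ t in (0 : ℝ)..(2 * Real.pi), bump y * Z y t = 0 := by
        intro y
        rw [intervalIntegral.integral_const_mul]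
        exact mul_eq_zero_of_right _ (h.Z_mean y)
      simp [this]
    · have hc : Continuous (uncurry fun a y => bump y * Z y a) := by fun_prop
      exact (hc.continuousOn.integrableOn_compact (isCompact_uIcc.prod isCompact_uIcc)).mono_set
        (Set.prod_mono Set.uIoc_subset_uIcc Set.uIoc_subset_uIcc)
  have c1 : Continuous fun a => ∫ y in (0 : ℝ)..1, bump y * Z y a :=
    intervalIntegral.continuous_parametric_intervalIntegral_of_continuous' (by fun_prop) _ _
  have h1 := abs_circInt_le_of_bound (f := fun a => (∫ y in (0 : ℝ)..1, bump y * Z y b)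
      - ∫ y in (0 : ℝ)..1, bump y * Z y a) (by fun_prop) (fun a ha => by
    rw [← intervalIntegral.integral_sub (Continuous.intervalIntegrable (by fun_prop) _ _)
      (Continuous.intervalIntegrable (by fun_prop) _ _)]
    simp only [← mul_sub]
    exact h.abs_bump_average_Z_sub_le hC₀ hN ha hb)
  rw [circInt_sub (by fun_prop) c1, hswap, sub_zero, circInt_const, abs_mul,
    abs_of_pos Real.two_pi_pos] at h1
  exact le_of_mul_le_mul_left h1 Real.two_pi_pos

end LocalBounds

end WaveProfile

lemma add_pow_four_le (a b : ℝ) : (a + b) ^ 4 ≤ 8 * (a ^ 4 + b ^ 4) := by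
  nlinarith [sq_nonneg (a - b), sq_nonneg (a ^ 2 - b ^ 2), sq_nonneg (a + b),
    mul_nonneg (sq_nonneg (a - b)) (sq_nonneg (a + b)), sq_nonneg ((a - b) ^ 2),
    mul_nonneg (sq_nonneg (a - b)) (sq_nonneg a), mul_nonneg (sq_nonneg (a - b)) (sq_nonneg b)]

lemma sq_le_one_add_pow_four (r : ℝ) : r ^ 2 ≤ 1 + r ^ 4 := by
  nlinarith [sq_nonneg (r ^ 2 - 1)]

lemma circInt_intervalIntegral_swap {F : ℝ → ℝ → ℝ} (hF : Continuous (uncurry F)) (a b : ℝ) :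
    circInt (fun t => ∫ y in a..b, F y t) = ∫ y in a..b, circInt (F y) := by
  unfold circInt
  rw [MeasureTheory.intervalIntegral_intervalIntegral_swap]
  have hc : Continuous (uncurry fun t y => F y t) := by fun_prop
  exact (hc.continuousOn.integrableOn_compact (isCompact_uIcc.prod isCompact_uIcc)).mono_set
    (Set.prod_mono Set.uIoc_subset_uIcc Set.uIoc_subset_uIcc)

lemma pow_four_circInt_le {g : ℝ → ℝ} (hg : Continuous g) :
    (circInt g) ^ 4 ≤ (2 * Real.pi) ^ 3 * circInt (fun t => g t ^ 4) := by
  simpa [circInt] using pow_four_integral_le hg Real.two_pi_pos.le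

lemma sq_circInt_le {g : ℝ → ℝ} (hg : Continuous g) :
    (circInt g) ^ 2 ≤ (2 * Real.pi) * circInt (fun t => g t ^ 2) := by
  simpa [circInt] using sq_integral_le hg Real.two_pi_pos.le

namespace WaveProfile

variable {s ω I C₀ : ℝ} {u v θ w Z q : ℝ → ℝ → ℝ} {N : ℝ}

/-- For each τ, the weighted ξ-average of `Z` is bounded and its oscillation is at most |ω| times
the ξ-integral of |u| + |mean u|. That oscillation is not bounded pointwise in τ by the mass, but
its fourth power is after integration in τ, by Hölder in ξ and Jensen for the mean. -/
lemma circInt_Z_pow_four_le (hC₀ : 0 ≤ C₀) (h : WaveProfile s ω I C₀ u v θ w Z q)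
    (hN : ∫ x in (0 : ℝ)..1, circInt (fun t => u x t ^ 4) ≤ N) {x : ℝ}
    (hx : x ∈ Set.Icc (0 : ℝ) 1) :
    circInt (fun t => Z x t ^ 4) ≤
      8 * (2 * Real.pi * (140 * (378 * (1 + 2 * C₀ + |s| + |I|) * (2 * Real.pi)
        + 378 * (1 + 2 * C₀ + |s| + |I|) * N)) ^ 4 + 16 * ω ^ 4 * N) := by
  have hu := h.cont_u
  have hZ := h.cont_Z
  set B := 378 * (1 + 2 * C₀ + |s| + |I|) * (2 * Real.pi) + 378 * (1 + 2 * C₀ + |s| + |I|) * N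
    with hB
  have cm : Continuous fun x => circInt (fun t => u x t ^ 4) := continuous_circInt (by fun_prop)
  obtain ⟨U, hU, cU⟩ : ∃ U : ℝ → ℝ, (∀ x, U x = circInt (u x) / (2 * Real.pi)) ∧ Continuous U :=
    ⟨_, fun _ => rfl, (continuous_circInt hu).div_const _⟩
  have cρ : Continuous fun t => ∫ y in (0 : ℝ)..1, (|u y t| + |U y|) :=
    intervalIntegral.continuous_parametric_intervalIntegral_of_continuous' (by fun_prop) _ _
  have pointwise : ∀ t ∈ Set.Icc 0 (2 * Real.pi),
      Z x t ^ 4 ≤ 8 * ((140 * B) ^ 4 +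
        ω ^ 4 * ∫ y in (0 : ℝ)..1, (|u y t| + |U y|) ^ 4) := by
    intro t ht
    have h1 : |Z x t| ≤ 140 * B + |ω| * ∫ y in (0 : ℝ)..1, (|u y t| + |U y|) := by
      refine abs_le_of_bump_average (g := fun y => Z y t) (by fun_prop)
        (h.abs_bump_average_Z_le hC₀ hN ht) fun y hy => ?_
      rw [← intervalIntegral.integral_eq_sub_of_hasDerivAt (f := fun y => Z y t)
        (f' := fun y => -ω * (u y t - U y))
        (fun y _ => by simpa only [hU] using h.Z_eq y t)
        (Continuous.intervalIntegrable (by fun_prop) _ _), ← intervalIntegral.integral_const_mul]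
      refine abs_integral_le_of_mem_Icc (by fun_prop) (by fun_prop) (fun y => ?_) hy hx
      rw [abs_mul, abs_neg]
      exact mul_le_mul_of_nonneg_left (abs_sub _ _) (abs_nonneg _)
    have h2 := pow_four_integral_le (g := fun y => |u y t| + |U y|) (by fun_prop)
      (zero_le_one (α := ℝ))
    calc Z x t ^ 4 = |Z x t| ^ 4 := ((by decide : Even 4).pow_abs _).symm
      _ ≤ (140 * B + |ω| * ∫ y in (0 : ℝ)..1, (|u y t| + |U y|)) ^ 4 :=
        pow_le_pow_left₀ (abs_nonneg _) h1 4
      _ ≤ 8 * ((140 * B) ^ 4 + (|ω| * ∫ y in (0 : ℝ)..1, (|u y t| + |U y|)) ^ 4) :=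
        add_pow_four_le _ _
      _ ≤ _ := by
        rw [mul_pow |ω|, (by decide : Even 4).pow_abs ω]
        have h3 := mul_le_mul_of_nonneg_left h2 ((by decide : Even 4).pow_nonneg ω)
        norm_num at h3
        linarith
  have cρ4 : Continuous fun t => ∫ y in (0 : ℝ)..1, (|u y t| + |U y|) ^ 4 :=
    intervalIntegral.continuous_parametric_intervalIntegral_of_continuous' (by fun_prop) _ _
  have hρ : circInt (fun t => ∫ y in (0 : ℝ)..1, (|u y t| + |U y|) ^ 4) ≤ 16 * N := by
    rw [circInt_intervalIntegral_swap (F := fun y t => (|u y t| + |U y|) ^ 4) (by fun_prop)]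
    calc ∫ y in (0 : ℝ)..1, circInt (fun t => (|u y t| + |U y|) ^ 4)
        ≤ ∫ y in (0 : ℝ)..1, 16 * circInt (fun t => u y t ^ 4) := by
          refine intervalIntegral.integral_mono zero_le_one
            ((continuous_circInt (by fun_prop)).intervalIntegrable _ _)
            ((by fun_prop : Continuous _).intervalIntegrable _ _) fun y => ?_
          refine (circInt_mono (by fun_prop) (g := fun t => 8 * (u y t ^ 4 + U y ^ 4))
            (by fun_prop) fun t => ?_).trans ?_
          · refine (add_pow_four_le _ _).trans_eq ?_
            rw [(by decide : Even 4).pow_abs, (by decide : Even 4).pow_abs]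
          · rw [circInt_const_mul, circInt_add (by fun_prop) (by fun_prop), circInt_const, hU,
              div_pow]
            have h1 := pow_four_circInt_le (g := u y) (by fun_prop)
            have h2 : 2 * Real.pi * (circInt (u y) ^ 4 / (2 * Real.pi) ^ 4) ≤
                circInt (fun t => u y t ^ 4) := by
              have : 2 * Real.pi * (circInt (u y) ^ 4 / (2 * Real.pi) ^ 4) =
                  circInt (u y) ^ 4 / (2 * Real.pi) ^ 3 := by
                field_simp
              rw [this, div_le_iff₀ (by positivity)]
              linarith
            linarith
      _ ≤ 16 * N := by
        rw [intervalIntegral.integral_const_mul]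
        linarith
  calc circInt (fun t => Z x t ^ 4)
      ≤ circInt (fun t => 8 * ((140 * B) ^ 4 +
        ω ^ 4 * ∫ y in (0 : ℝ)..1, (|u y t| + |U y|) ^ 4)) :=
        circInt_mono_on (by fun_prop) (by fun_prop) pointwise
    _ = 8 * (2 * Real.pi * (140 * B) ^ 4 +
        ω ^ 4 * circInt (fun t => ∫ y in (0 : ℝ)..1, (|u y t| + |U y|) ^ 4)) := by
      rw [circInt_const_mul, circInt_add (by fun_prop) (by fun_prop), circInt_const,
        circInt_const_mul]
    _ ≤ _ := by
      have := mul_le_mul_of_nonneg_left hρ ((by decide : Even 4).pow_nonneg ω)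
      linarith

/-- The local average of the energy is controlled by the local `L⁴` mass of `u`. -/
lemma exists_bound_bump_average_energy (s ω I C₀ N : ℝ) (hs : s ≠ 0) (hω : ω ≠ 0)
    (hC₀ : 0 ≤ C₀) :
    ∃ X : ℝ, ∀ u v θ w Z q : ℝ → ℝ → ℝ, WaveProfile s ω I C₀ u v θ w Z q →
      ∫ x in (0 : ℝ)..1, circInt (fun t => u x t ^ 4) ≤ N →
      |∫ x in (0 : ℝ)..1, bump x * waveEnergy s ω I u v θ Z x| ≤ X := by
  -- T and z are the bounds for the mean of θ and for the L⁴ mass of `Z` on a ξ-slice; both depend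
  -- on the wave only through N.
  obtain ⟨T, hT⟩ : ∃ T, T = 140 * (378 * 3 * (2 * Real.pi) + 378 * 3 * N)
      + ((2 * Real.pi * |I| + |s| * (2 * Real.pi)) + |s| * N) := ⟨_, rfl⟩
  obtain ⟨z, hz⟩ : ∃ z, z = 8 * (2 * Real.pi * (140 * (378 * (1 + 2 * C₀ + |s| + |I|) *
      (2 * Real.pi) + 378 * (1 + 2 * C₀ + |s| + |I|) * N)) ^ 4 + 16 * ω ^ 4 * N) := ⟨_, rfl⟩
  refine ⟨378 * ((2 * Real.pi + z) / |ω| + (2 + |I / s|) * (2 * Real.pi)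
    + (T ^ 2 / |2 * s * (2 * Real.pi)| + |s / (2 * ω ^ 2)| * (2 * Real.pi + z)
      + 2 * (2 * Real.pi + z) / |ω|)) + 378 * (3 / |ω| + 2 + |I / s|) * N,
    fun u v θ w Z q h hN => ?_⟩
  have hu := h.cont_u
  have hZ := h.cont_Z
  have hθ := h.cont_θ
  have cU : Continuous fun x => circInt (u x) := continuous_circInt hu
  have cθ : Continuous fun x => circInt (θ x) := continuous_circInt hθ
  have cu2 : Continuous fun x => circInt (fun t => u x t ^ 2) := continuous_circInt (by fun_prop)
  have cuZ : Continuous fun x => circInt (fun t => u x t * Z x t) :=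
    continuous_circInt (by fun_prop)
  have cZ2 : Continuous fun x => circInt (fun t => Z x t ^ 2) := continuous_circInt (by fun_prop)
  have cfZ : Continuous fun x => circInt (fun t => (u x t ^ 3 - u x t) * Z x t) :=
    continuous_circInt (by fun_prop)
  have cm : Continuous fun x => circInt (fun t => u x t ^ 4) := continuous_circInt (by fun_prop)
  rw [h.integral_bump_mul_energy hs hω]
  refine abs_integral_unit_le (by fun_prop) cm (by positivity) hN fun x hx => ?_
  obtain ⟨b0, b1, b2, -⟩ := abs_bump_le hx
  have bθ := h.abs_circInt_θ_le hN hx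
  have bz := h.circInt_Z_pow_four_le hC₀ hN hx
  rw [← hT] at bθ
  rw [← hz] at bz
  have split : ∀ c : ℝ, c * circInt (fun t => 1 + u x t ^ 4 + Z x t ^ 4) =
      c * (2 * Real.pi + circInt (fun t => u x t ^ 4) + circInt (fun t => Z x t ^ 4)) := by
    intro c
    rw [circInt_add (by fun_prop) (by fun_prop), circInt_add (by fun_prop) (by fun_prop),
      circInt_const, mul_one]
  have buZ : |circInt (fun t => u x t * Z x t)| ≤
      2 * Real.pi + circInt (fun t => u x t ^ 4) + z := by
    refine (abs_circInt_le (by fun_prop) (by fun_prop)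
      fun t => abs_mul_le_one_add (u x t) (Z x t)).trans ?_
    have := split 1
    linarith
  have bfZ : |circInt (fun t => (u x t ^ 3 - u x t) * Z x t)| ≤
      2 * (2 * Real.pi + circInt (fun t => u x t ^ 4) + z) := by
    refine (abs_circInt_le (by fun_prop) (by fun_prop)
      fun t => abs_cube_sub_mul_le (u x t) (Z x t)).trans ?_
    rw [circInt_const_mul, split]
    linarith
  have bu : |circInt (u x)| ≤ 2 * Real.pi + circInt (fun t => u x t ^ 4) := by
    refine (abs_circInt_le (by fun_prop) (by fun_prop)
      fun t => abs_le_one_add_pow_four (u x t)).trans_eq ?_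
    rw [circInt_add (by fun_prop) (by fun_prop), circInt_const, mul_one]
  have bu2 : circInt (fun t => u x t ^ 2) ≤ 2 * Real.pi + circInt (fun t => u x t ^ 4) := by
    refine (circInt_mono (by fun_prop) (g := fun t => 1 + u x t ^ 4) (by fun_prop)
      fun t => ?_).trans_eq ?_
    · exact sq_le_one_add_pow_four _
    · rw [circInt_add (by fun_prop) (by fun_prop), circInt_const, mul_one]
  have bu2' : 0 ≤ circInt (fun t => u x t ^ 2) :=
    intervalIntegral.integral_nonneg (by positivity) fun t _ => by positivity
  have bU2 : circInt (u x) ^ 2 / (2 * Real.pi) ≤ circInt (fun t => u x t ^ 2) := by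
    rw [div_le_iff₀ Real.two_pi_pos, mul_comm]
    exact sq_circInt_le (by fun_prop)
  have bU2' : 0 ≤ circInt (u x) ^ 2 / (2 * Real.pi) := by positivity
  have bZ2 : |circInt (fun t => Z x t ^ 2)| ≤ 2 * Real.pi + z := by
    refine (abs_circInt_le (by fun_prop) (g := fun t => 1 + Z x t ^ 4) (by fun_prop)
      fun t => ?_).trans ?_
    · rw [abs_of_nonneg (sq_nonneg _)]
      exact sq_le_one_add_pow_four _
    · rw [circInt_add (by fun_prop) (by fun_prop), circInt_const, mul_one]
      linarith
  set m := circInt (fun t => u x t ^ 4)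
  have t1 : |circInt (fun t => u x t * Z x t) / ω| ≤ (2 * Real.pi + z) / |ω| + 1 / |ω| * m := by
    rw [abs_div]
    calc _ ≤ (2 * Real.pi + m + z) / |ω| := by gcongr
      _ = _ := by ring
  have t2 : |3 / 2 * (circInt (fun t => u x t ^ 2) - circInt (u x) ^ 2 / (2 * Real.pi))
      + circInt (fun t => u x t ^ 2) / 2 + I / s * circInt (u x)| ≤
      (2 + |I / s|) * (2 * Real.pi) + (2 + |I / s|) * m := by
    refine (abs_add_le _ _).trans ?_
    rw [abs_mul]
    have e1 := mul_le_mul_of_nonneg_left bu (abs_nonneg (I / s))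
    have e2 : |3 / 2 * (circInt (fun t => u x t ^ 2) - circInt (u x) ^ 2 / (2 * Real.pi))
      + circInt (fun t => u x t ^ 2) / 2| ≤ 2 * (2 * Real.pi + m) := by
      rw [abs_of_nonneg (by linarith)]
      linarith
    linarith
  have t3 : |-(circInt (θ x) ^ 2 / (2 * s * (2 * Real.pi)))
      + s / (2 * ω ^ 2) * circInt (fun t => Z x t ^ 2)
      - circInt (fun t => (u x t ^ 3 - u x t) * Z x t) / ω| ≤
      (T ^ 2 / |2 * s * (2 * Real.pi)| + |s / (2 * ω ^ 2)| * (2 * Real.pi + z)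
      + 2 * (2 * Real.pi + z) / |ω|) + 2 / |ω| * m := by
    refine (abs_sub _ _).trans ((add_le_add_left (abs_add_le _ _) _).trans ?_)
    rw [abs_neg, abs_div, abs_mul (s / (2 * ω ^ 2)), abs_div _ ω, abs_pow]
    calc _ ≤ T ^ 2 / |2 * s * (2 * Real.pi)| + |s / (2 * ω ^ 2)| * (2 * Real.pi + z)
        + 2 * (2 * Real.pi + m + z) / |ω| := by gcongr
      _ = _ := by ring
  refine (abs_add_le _ _).trans ((add_le_add_left (abs_sub _ _) _).trans ?_)
  rw [abs_mul, abs_mul, abs_mul]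
  have r1 := mul_le_mul b2 t1 (abs_nonneg _) (by norm_num)
  have r2 := mul_le_mul b1 t2 (abs_nonneg _) (by norm_num)
  have r3 := mul_le_mul b0 t3 (abs_nonneg _) (by norm_num)
  calc _ ≤ _ := add_le_add (add_le_add r1 r2) r3
    _ = _ := by ring

/-! ### From averaged to pointwise energy bounds, and the extremal argument -/

lemma continuous_energy (h : WaveProfile s ω I C₀ u v θ w Z q) (hs : s ≠ 0) (hω : ω ≠ 0) :
    Continuous (waveEnergy s ω I u v θ Z) :=
  continuous_iff_continuousAt.2 fun x => (h.hasDerivAt_energy hs hω x).continuousAt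

/-- Pointwise bounds of the energy from one side by the local `L⁴` mass on the other side. -/
lemma exists_energy_bound (s ω I C₀ N : ℝ) (hs : s ≠ 0) (hω : ω ≠ 0) (hC₀ : 0 ≤ C₀) :
    ∃ X : ℝ, ∀ u v θ w Z q : ℝ → ℝ → ℝ, WaveProfile s ω I C₀ u v θ w Z q → ∀ a : ℝ,
      ∫ x in a..(a + 1), circInt (fun t => u x t ^ 4) ≤ N →
      waveEnergy s ω I u v θ Z a ≤ X ∧ -X ≤ waveEnergy s ω I u v θ Z (a + 1) := by
  obtain ⟨X, hX⟩ := exists_bound_bump_average_energy s ω I C₀ N hs hω hC₀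
  set D := 2 * Real.pi * (10 * (1 + (I / s) ^ 2) ^ 2) with hD
  have hD0 : 0 ≤ D := by positivity
  refine ⟨140 * X + D, fun u v θ w Z q h a hN => ?_⟩
  have h' := h.shift a
  have hN' : ∫ x in (0 : ℝ)..1, circInt (fun t => u (x + a) t ^ 4) ≤ N := by
    rw [intervalIntegral.integral_comp_add_right (fun x => circInt (fun t => u x t ^ 4))]
    simpa [add_comm] using hN
  have hb := hX _ _ _ _ _ _ h' hN'
  simp only [shift_energy] at hb
  have hE := h.continuous_energy hs hω
  -- Over a distance of at most 1 the energy can drop by at most D. Comparing the value at an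
  -- endpoint with the weighted average therefore costs D, and the factor 140 normalises the weight.
  have mono : ∀ x y, x ≤ y → y ≤ x + 1 →
      waveEnergy s ω I u v θ Z x ≤ waveEnergy s ω I u v θ Z y + D := by
    intro x y hxy hyx
    have h1 := h.energy_sub_ge hs hω hxy
    have h2 : 0 ≤ ∫ x in x..y, circInt (fun t => u x t ^ 4) :=
      intervalIntegral.integral_nonneg hxy fun x _ =>
        intervalIntegral.integral_nonneg (by positivity) fun t _ => by positivity
    rw [← hD] at h1
    nlinarith [mul_le_mul_of_nonneg_right (by linarith : y - x ≤ 1) hD0]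
  rw [abs_le] at hb
  constructor
  · have : ∫ x in (0 : ℝ)..1, bump x * (waveEnergy s ω I u v θ Z a - D) ≤
        ∫ x in (0 : ℝ)..1, bump x * waveEnergy s ω I u v θ Z (x + a) := by
      refine intervalIntegral.integral_mono_on zero_le_one
        (Continuous.intervalIntegrable (by fun_prop) _ _)
        (Continuous.intervalIntegrable (by fun_prop) _ _) fun x hx =>
          mul_le_mul_of_nonneg_left ?_ (bump_nonneg hx)
      linarith [mono a (x + a) (by linarith [hx.1]) (by linarith [hx.2])]
    rw [intervalIntegral.integral_mul_const, integral_bump] at this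
    linarith
  · have : ∫ x in (0 : ℝ)..1, bump x * waveEnergy s ω I u v θ Z (x + a) ≤
        ∫ x in (0 : ℝ)..1, bump x * (waveEnergy s ω I u v θ Z (a + 1) + D) := by
      refine intervalIntegral.integral_mono_on zero_le_one
        (Continuous.intervalIntegrable (by fun_prop) _ _)
        (Continuous.intervalIntegrable (by fun_prop) _ _) fun x hx =>
          mul_le_mul_of_nonneg_left ?_ (bump_nonneg hx)
      linarith [mono (x + a) (a + 1) (by linarith [hx.2]) (by linarith [hx.1])]
    rw [intervalIntegral.integral_mul_const, integral_bump] at this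
    linarith

/-- The `L⁴` mass of a bounded wave on unit intervals is bounded in terms of `s`, `ω` and `I`. -/
theorem exists_mass_bound (s ω I C₀ : ℝ) (hs : s ≠ 0) (hω : ω ≠ 0) (hC₀ : 0 ≤ C₀) :
    ∃ K : ℝ, ∀ u v θ w Z q : ℝ → ℝ → ℝ, WaveProfile s ω I C₀ u v θ w Z q →
      (∃ M : ℝ, ∀ x t, |u x t| ≤ M) → ∀ a : ℝ,
      ∫ x in a..(a + 1), circInt (fun t => u x t ^ 4) ≤ K := by
  set D := 2 * Real.pi * (10 * (1 + (I / s) ^ 2) ^ 2) with hD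
  -- 2(1 + D) is the largest mass compatible with an energy growth of at most 1 over a unit
  -- interval.
  obtain ⟨X, hX⟩ := exists_energy_bound s ω I C₀ (2 * (1 + D)) hs hω hC₀
  refine ⟨2 * (2 * X + 2 + D), fun u v θ w Z q h ⟨M, hM⟩ a => ?_⟩
  have hu := h.cont_u
  have drift : ∀ a, (∫ x in a..(a + 1), circInt (fun t => u x t ^ 4)) / 2 - D ≤
      waveEnergy s ω I u v θ Z (a + 1) - waveEnergy s ω I u v θ Z a := by
    intro a
    have := h.energy_sub_ge hs hω (by linarith : a ≤ a + 1)
    rw [← hD] at this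
    linarith
  have apriori : ∀ a, ∫ x in a..(a + 1), circInt (fun t => u x t ^ 4) ≤ 2 * Real.pi * M ^ 4 := by
    intro a
    have c : Continuous fun x => circInt (fun t => u x t ^ 4) := continuous_circInt (by fun_prop)
    refine (intervalIntegral.integral_mono (by linarith) (c.intervalIntegrable _ _)
      (intervalIntegrable_const (c := 2 * Real.pi * M ^ 4)) fun x => ?_).trans_eq (by simp)
    rw [← circInt_const]
    refine circInt_mono (by fun_prop) (by fun_prop) fun t => ?_
    rw [← (by decide : Even 4).pow_abs]
    exact pow_le_pow_left₀ (abs_nonneg _) (hM x t) 4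
  -- Y depends on the sup norm of u and serves only to make the supremum and infimum of the energy
  -- finite; it does not enter the final constant.
  obtain ⟨Y, hY⟩ := exists_energy_bound s ω I C₀ (2 * Real.pi * M ^ 4) hs hω hC₀
  have hY' := fun a => hY u v θ w Z q h a (apriori a)
  have bddA : BddAbove (Set.range (waveEnergy s ω I u v θ Z)) :=
    ⟨Y, by rintro _ ⟨x, rfl⟩; exact (hY' x).1⟩
  have bddB : BddBelow (Set.range (waveEnergy s ω I u v θ Z)) :=
    ⟨-Y, by rintro _ ⟨x, rfl⟩; simpa using (hY' (x - 1)).2⟩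
  -- Start within 1 of the supremum: the energy cannot grow by more than 1 on the next interval, so
  -- the mass there is at most 2(1 + D) and the energy at its left end is at most X.
  have upper : ∀ x, waveEnergy s ω I u v θ Z x ≤ X + 1 := by
    intro x
    obtain ⟨_, ⟨b, rfl⟩, hb⟩ := exists_lt_of_lt_csSup (Set.range_nonempty _)
      (sub_one_lt (sSup (Set.range (waveEnergy s ω I u v θ Z))))
    have h1 := le_csSup bddA (Set.mem_range_self (b + 1))
    have h2 := le_csSup bddA (Set.mem_range_self x)
    have h3 := (hX u v θ w Z q h b (by linarith [drift b])).1
    linarith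
  -- The mirror image: a point within 1 of the infimum is taken as the right end of the unit
  -- interval.
  have lower : ∀ x, -(X + 1) ≤ waveEnergy s ω I u v θ Z x := by
    intro x
    obtain ⟨_, ⟨b, rfl⟩, hb⟩ := exists_lt_of_csInf_lt (Set.range_nonempty _)
      (lt_add_one (sInf (Set.range (waveEnergy s ω I u v θ Z))))
    obtain ⟨c, rfl⟩ : ∃ c, b = c + 1 := ⟨b - 1, by ring⟩
    have h1 := csInf_le bddB (Set.mem_range_self c)
    have h2 := csInf_le bddB (Set.mem_range_self x)
    have h3 := (hX u v θ w Z q h c (by linarith [drift c])).2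
    linarith
  linarith [drift a, upper (a + 1), lower a]

end WaveProfile

/-! ### Sawtooth sums, the Dirichlet kernel and the Galerkin projection -/

/-- The partial sums `∑_{k = 1}^n sin(k x) / k` of the sawtooth series. -/
noncomputable def sineSum (n : ℕ) (x : ℝ) : ℝ :=
  ∑ i ∈ Finset.range n, Real.sin ((i + 1) * x) / (i + 1)

lemma abs_sineSum_le_mul (n : ℕ) {x : ℝ} (hx : 0 ≤ x) : |sineSum n x| ≤ n * x := by
  refine (Finset.abs_sum_le_sum_abs _ _).trans ?_
  calc ∑ i ∈ Finset.range n, |Real.sin ((i + 1) * x) / (i + 1)|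
      ≤ ∑ _i ∈ Finset.range n, x := by
        refine Finset.sum_le_sum fun i _ => ?_
        have hi : (0 : ℝ) < i + 1 := by positivity
        rw [abs_div, abs_of_pos hi, div_le_iff₀ hi]
        refine (Real.abs_sin_le_abs).trans ?_
        rw [abs_of_nonneg (by positivity), mul_comm]
    _ = n * x := by simp

/-- Abel summation in inductive form. Multiplication by 2 sin(x/2) makes the sines telescope into
cosines; the last boundary cosine is kept on the left, and the differences of 1/k telescope on the
right. -/
lemma abs_sineSum_tail_le (m j : ℕ) (x : ℝ) :
    |2 * Real.sin (x / 2) * (sineSum (m + j) x - sineSum m x)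
      + Real.cos ((m + j + 1 / 2) * x) / (m + j + 1)| ≤ 2 / (m + 1) - 1 / (m + j + 1) := by
  induction j with
  | zero =>
    simp only [add_zero, sub_self, mul_zero, zero_add, CharP.cast_eq_zero]
    have hi : (0 : ℝ) < m + 1 := by positivity
    rw [abs_div, abs_of_pos hi, ← sub_div]
    gcongr
    linarith [Real.abs_cos_le_one ((m + 1 / 2) * x)]
  | succ j ih =>
    have e : 2 * Real.sin (x / 2) * (Real.sin ((((m + j : ℕ) : ℝ) + 1) * x)) =
        Real.cos ((m + j + 1 / 2) * x) - Real.cos ((m + (j + 1 : ℕ) + 1 / 2) * x) := by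
      rw [Real.cos_sub_cos]
      have h1 : ((m + j + 1 / 2) * x + (m + (j + 1 : ℕ) + 1 / 2) * x) / 2 =
          (((m + j : ℕ) : ℝ) + 1) * x := by push_cast; ring
      have h2 : ((m + j + 1 / 2) * x - (m + (j + 1 : ℕ) + 1 / 2) * x) / 2 = -(x / 2) := by
        push_cast; ring
      rw [h1, h2, Real.sin_neg]
      ring
    have hp : (0 : ℝ) < m + j + 1 := by positivity
    have hq : (0 : ℝ) < m + j + 2 := by positivity
    have e2 : 2 * Real.sin (x / 2) * (sineSum (m + (j + 1)) x - sineSum m x)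
        + Real.cos ((m + (j + 1 : ℕ) + 1 / 2) * x) / (m + (j + 1 : ℕ) + 1) =
        (2 * Real.sin (x / 2) * (sineSum (m + j) x - sineSum m x)
        + Real.cos ((m + j + 1 / 2) * x) / (m + j + 1))
        - Real.cos ((m + (j + 1 : ℕ) + 1 / 2) * x) * (1 / (m + j + 1) - 1 / (m + j + 2)) := by
      have : sineSum (m + (j + 1)) x = sineSum (m + j) x
          + Real.sin ((((m + j : ℕ) : ℝ) + 1) * x) / ((m + j : ℕ) + 1) := by
        rw [sineSum, ← add_assoc, Finset.sum_range_succ]; rfl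
      rw [this]
      have e3 : 2 * Real.sin (x / 2) * (sineSum (m + j) x
          + Real.sin ((((m + j : ℕ) : ℝ) + 1) * x) / ((m + j : ℕ) + 1) - sineSum m x) =
          2 * Real.sin (x / 2) * (sineSum (m + j) x - sineSum m x) +
          (2 * Real.sin (x / 2) * Real.sin ((((m + j : ℕ) : ℝ) + 1) * x)) / (m + j + 1) := by
        push_cast; ring
      rw [e3, e]
      have e4 : (m : ℝ) + (j + 1 : ℕ) + 1 = m + j + 2 := by push_cast; ring
      rw [e4]
      field_simp
      ring
    rw [e2]
    have hd : (0 : ℝ) ≤ 1 / (m + j + 1) - 1 / (m + j + 2) := by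
      rw [sub_nonneg]; gcongr; norm_num
    have hc := Real.abs_cos_le_one ((m + (j + 1 : ℕ) + 1 / 2) * x)
    refine (abs_sub _ _).trans ?_
    rw [abs_mul, abs_of_nonneg hd]
    have e4 : (m : ℝ) + (j + 1 : ℕ) + 1 = m + j + 2 := by push_cast; ring
    rw [e4]
    nlinarith [mul_le_mul_of_nonneg_right hc hd]

/-- Split at m = ⌊1/x⌋. The first m terms are at most x each and contribute at most 1. In the tail,
sin(x/2) ≥ x/π and (m + 1)x > 1 turn the Abel bound into π. -/
lemma abs_sineSum_le_of_mem (n : ℕ) {x : ℝ} (h0 : 0 < x) (hpi : x ≤ Real.pi) :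
    |sineSum n x| ≤ 1 + Real.pi := by
  have hpi0 := Real.pi_pos
  set m := ⌊1 / x⌋₊ with hm
  have hm1 : m * x ≤ 1 := by
    have := Nat.floor_le (a := 1 / x) (by positivity)
    rwa [le_div_iff₀ h0] at this
  have hm2 : 1 < (m + 1) * x := by
    have := Nat.lt_floor_add_one (1 / x)
    rwa [div_lt_iff₀ h0] at this
  rcases le_total n m with hnm | hnm
  · refine (abs_sineSum_le_mul n h0.le).trans ?_
    have : (n : ℝ) ≤ m := by exact_mod_cast hnm
    nlinarith
  · obtain ⟨j, rfl⟩ := Nat.exists_eq_add_of_le hnm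
    have h1 := (abs_sineSum_le_mul m h0.le).trans hm1
    have h2 := abs_sineSum_tail_le m j x
    have hp : (0 : ℝ) < m + j + 1 := by positivity
    have h3 : |Real.cos ((m + j + 1 / 2) * x) / (m + j + 1)| ≤ 1 / (m + j + 1) := by
      rw [abs_div, abs_of_pos hp]
      gcongr
      exact Real.abs_cos_le_one _
    have h4 : |2 * Real.sin (x / 2) * (sineSum (m + j) x - sineSum m x)| ≤ 2 / (m + 1) := by
      rw [abs_le] at *
      constructor <;> linarith [h2.1, h2.2, h3.1, h3.2]
    have h5 := Real.mul_le_sin (x := x / 2) (by linarith) (by linarith)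
    have h6 : x / Real.pi ≤ Real.sin (x / 2) := by
      calc x / Real.pi = 2 / Real.pi * (x / 2) := by ring
        _ ≤ _ := h5
    have h7 : 0 < x / Real.pi := by positivity
    rw [abs_mul, abs_mul, abs_of_pos (two_pos : (0 : ℝ) < 2), abs_of_pos (h7.trans_le h6),
      le_div_iff₀ (by positivity)] at h4
    have h8 : |sineSum (m + j) x - sineSum m x| ≤ Real.pi := by
      set d := |sineSum (m + j) x - sineSum m x|
      have hd : 0 ≤ d := abs_nonneg _
      have h9 : x / Real.pi * d * (m + 1) ≤ 1 := by
        have : x / Real.pi * d * (m + 1) ≤ Real.sin (x / 2) * d * (m + 1) := by gcongr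
        linarith
      have h10 : d * ((m + 1) * x) ≤ Real.pi := by
        calc d * ((m + 1) * x) = Real.pi * (x / Real.pi * d * (m + 1)) := by field_simp
          _ ≤ Real.pi * 1 := by gcongr
          _ = _ := mul_one _
      nlinarith
    calc |sineSum (m + j) x| = |sineSum m x + (sineSum (m + j) x - sineSum m x)| := by congr 1; ring
      _ ≤ _ := (abs_add_le _ _).trans (add_le_add h1 h8)

lemma sineSum_periodic (n : ℕ) : Periodic (sineSum n) (2 * Real.pi) := by
  intro x
  unfold sineSum
  refine Finset.sum_congr rfl fun i _ => ?_
  have : ((i : ℝ) + 1) * (x + 2 * Real.pi) = (i + 1) * x + ((i + 1 : ℕ) : ℝ) * (2 * Real.pi) := by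
    push_cast; ring
  rw [this, Real.sin_add_nat_mul_two_pi]

lemma sineSum_neg (n : ℕ) (x : ℝ) : sineSum n (-x) = -sineSum n x := by
  simp [sineSum, neg_div]

/-- The partial sums of the sawtooth series are uniformly bounded. -/
lemma abs_sineSum_le (n : ℕ) (x : ℝ) : |sineSum n x| ≤ 1 + Real.pi := by
  obtain ⟨y, hy, hxy⟩ := (sineSum_periodic n).exists_mem_Ioc Real.two_pi_pos x (-Real.pi)
  rw [hxy]
  have hpi := Real.pi_pos
  have h1 := hy.1
  have h2 : y ≤ Real.pi := by linarith [hy.2]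
  rcases lt_trichotomy y 0 with h | rfl | h
  · rw [← neg_neg y, sineSum_neg, abs_neg]
    exact abs_sineSum_le_of_mem n (by linarith) (by linarith)
  · simp [sineSum]; positivity
  · exact abs_sineSum_le_of_mem n h h2

/-- The Dirichlet kernel `∑_{|l| ≤ n} e^{ilx}`. -/
noncomputable def dirichletSum (n : ℕ) (x : ℝ) : ℝ :=
  1 + 2 * ∑ i ∈ Finset.range n, Real.cos ((i + 1) * x)

@[fun_prop] lemma continuous_dirichletSum (n : ℕ) : Continuous (dirichletSum n) := by
  unfold dirichletSum; fun_prop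

lemma dirichletSum_neg (n : ℕ) (x : ℝ) : dirichletSum n (-x) = dirichletSum n x := by
  simp [dirichletSum]

lemma dirichletSum_periodic (n : ℕ) : Periodic (dirichletSum n) (2 * Real.pi) := by
  intro x
  unfold dirichletSum
  congr 2
  refine Finset.sum_congr rfl fun i _ => ?_
  have : ((i : ℝ) + 1) * (x + 2 * Real.pi) = (i + 1) * x + ((i + 1 : ℕ) : ℝ) * (2 * Real.pi) := by
    push_cast; ring
  rw [this, Real.cos_add_nat_mul_two_pi]

lemma hasDerivAt_sineSum (n : ℕ) (x : ℝ) :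
    HasDerivAt (fun y => y + 2 * sineSum n y) (dirichletSum n x) x := by
  unfold sineSum dirichletSum
  refine (hasDerivAt_id x).add (HasDerivAt.const_mul 2 (HasDerivAt.fun_sum fun i _ => ?_))
  have h := (((hasDerivAt_id x).const_mul ((i : ℝ) + 1)).sin.div_const ((i : ℝ) + 1))
  refine h.congr_deriv ?_
  have : (i : ℝ) + 1 ≠ 0 := by positivity
  simp only [id]
  field_simp

lemma dirichletSum_eq (n : ℕ) (x : ℝ) :
    dirichletSum n x = ∑ l ∈ Finset.Icc (-(n : ℤ)) (n : ℤ), Real.cos (l * x) := by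
  rw [Finset.sum_Icc_of_even_eq_range (by intro l; simp), Finset.sum_range_succ']
  simp [dirichletSum]
  ring

/-- The convolution form makes continuity, differentiation in a parameter, symmetry and bounds on
primitives properties of the kernel. -/
lemma galerkin_eq_integral (n : ℕ) {g : ℝ → ℝ} (hg : Continuous g) (t : ℝ) :
    galerkin n g t = (2 * Real.pi)⁻¹ * circInt (fun r => g r * dirichletSum n (t - r)) := by
  have h1 : ∀ l : ℤ, (fourierMode g l * Complex.exp (Complex.I * l * t)).re =
      (2 * Real.pi)⁻¹ * ∫ r in (0 : ℝ)..(2 * Real.pi), g r * Real.cos (l * (t - r)) := by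
    intro l
    have e1 : fourierMode g l * Complex.exp (Complex.I * l * t) =
        (((2 * Real.pi)⁻¹ : ℝ) : ℂ) * ∫ r in (0 : ℝ)..(2 * Real.pi),
          (g r : ℂ) * Complex.exp ((l * (t - r) : ℝ) * Complex.I) := by
      rw [fourierMode, mul_assoc, ← intervalIntegral.integral_mul_const]
      push_cast
      congr 2; ext r
      rw [mul_assoc, ← Complex.exp_add]
      congr 2; ring
    rw [e1, Complex.re_ofReal_mul]
    congr 1
    have e2 := Complex.reCLM.intervalIntegral_comp_comm (μ := volume) (a := 0) (b := 2 * Real.pi)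
      (f := fun r : ℝ => (g r : ℂ) * Complex.exp ((l * (t - r) : ℝ) * Complex.I))
      (Continuous.intervalIntegrable (by fun_prop) _ _)
    rw [← Complex.reCLM_apply, ← e2]
    congr 1; ext r
    rw [Complex.reCLM_apply, Complex.re_ofReal_mul, Complex.exp_ofReal_mul_I_re]
  change (fourierSum n g t).re = _
  rw [fourierSum, Complex.re_sum]
  simp only [h1, dirichletSum_eq, Finset.mul_sum, circInt]
  rw [intervalIntegral.integral_finsetSum, Finset.mul_sum]
  intro l _
  exact Continuous.intervalIntegrable (by fun_prop) _ _

lemma circInt_swap {F : ℝ → ℝ → ℝ} (hF : Continuous (uncurry F)) (a b : ℝ) :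
    ∫ t in a..b, circInt (F t) = circInt (fun r => ∫ t in a..b, F t r) :=
  (circInt_intervalIntegral_swap hF a b).symm

lemma continuous_galerkin (n : ℕ∞) {F : ℝ → ℝ → ℝ} (hF : Continuous (uncurry F)) :
    Continuous (uncurry fun x => galerkin n (F x)) := by
  cases n with
  | top => exact hF
  | coe n =>
    have : (uncurry fun x => galerkin n (F x)) = fun p : ℝ × ℝ =>
        (2 * Real.pi)⁻¹ * circInt (fun r => F p.1 r * dirichletSum n (p.2 - r)) := by
      ext p
      exact galerkin_eq_integral n (by fun_prop) _
    rw [this]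
    refine continuous_const.mul ?_
    exact intervalIntegral.continuous_parametric_intervalIntegral_of_continuous' (by fun_prop) _ _

lemma hasDerivAt_galerkin (n : ℕ∞) {F F' : ℝ → ℝ → ℝ} (hF : ∀ x, Continuous (F x))
    (hF' : Continuous (uncurry F')) (h : ∀ x t, HasDerivAt (fun y => F y t) (F' x t) x)
    (x t : ℝ) : HasDerivAt (fun y => galerkin n (F y) t) (galerkin n (F' x) t) x := by
  cases n with
  | top => exact h x t
  | coe n =>
    have hc : ∀ x, Continuous (F' x) := fun x => by fun_prop
    simp only [galerkin_eq_integral n (hF _), galerkin_eq_integral n (hc _)]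
    refine HasDerivAt.const_mul _ (hasDerivAt_circInt (F := fun y r => F y r * dirichletSum n (t - r))
      (F' := fun y r => F' y r * dirichletSum n (t - r))
      (fun x => ?_) (by fun_prop) (fun x r => (h x r).mul_const _) x)
    have := hF x
    fun_prop

lemma galerkin_periodic (n : ℕ∞) {g : ℝ → ℝ} (hg : Continuous g) (hp : Periodic g (2 * Real.pi)) :
    Periodic (galerkin n g) (2 * Real.pi) := by
  cases n with
  | top => exact hp
  | coe n =>
    intro t
    rw [galerkin_eq_integral n hg, galerkin_eq_integral n hg]
    congr 2; ext r
    rw [add_sub_right_comm, dirichletSum_periodic]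

/-- P_n is symmetric because the Dirichlet kernel is even. -/
lemma circInt_galerkin_mul (n : ℕ∞) {f g : ℝ → ℝ} (hf : Continuous f) (hg : Continuous g) :
    circInt (fun t => galerkin n f t * g t) = circInt (fun t => f t * galerkin n g t) := by
  cases n with
  | top => rfl
  | coe n =>
    simp only [galerkin_eq_integral n hf, galerkin_eq_integral n hg]
    have e1 : ∀ t, (2 * Real.pi)⁻¹ * circInt (fun r => f r * dirichletSum n (t - r)) * g t =
        circInt (fun r => (2 * Real.pi)⁻¹ * g t * (f r * dirichletSum n (t - r))) := by
      intro t; rw [circInt_const_mul]; ring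
    have e2 : ∀ t, f t * ((2 * Real.pi)⁻¹ * circInt (fun r => g r * dirichletSum n (t - r))) =
        circInt (fun r => (2 * Real.pi)⁻¹ * f t * (g r * dirichletSum n (t - r))) := by
      intro t; rw [circInt_const_mul]; ring
    simp only [e1, e2]
    rw [circInt, circInt_swap (by fun_prop)]
    congr 1; ext r
    unfold circInt
    congr 1; ext t
    rw [← dirichletSum_neg, neg_sub]
    ring

/-- The primitives of `P_n g` are bounded by the `L¹` norm of `g`, uniformly in `n`. -/
lemma abs_integral_galerkin_le (n : ℕ∞) {g : ℝ → ℝ} (hg : Continuous g) {a b : ℝ}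
    (ha : a ∈ Set.Icc 0 (2 * Real.pi)) (hb : b ∈ Set.Icc 0 (2 * Real.pi)) :
    |∫ t in a..b, galerkin n g t| ≤ 4 * circInt (fun t => |g t|) := by
  have h0 : 0 ≤ circInt (fun t => |g t|) :=
    intervalIntegral.integral_nonneg (by positivity) fun t _ => abs_nonneg _
  cases n with
  | top =>
    have := abs_integral_le_of_mem_Icc hg (g := fun t => |g t|) (by fun_prop) (fun t => le_rfl) ha hb
    change |∫ t in a..b, g t| ≤ _
    refine this.trans ?_
    change circInt _ ≤ _
    linarith
  | coe n =>
    simp only [galerkin_eq_integral n hg]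
    rw [intervalIntegral.integral_const_mul,
      circInt_swap (F := fun t r => g r * dirichletSum n (t - r)) (by fun_prop), abs_mul,
      abs_of_pos (by positivity : (0 : ℝ) < (2 * Real.pi)⁻¹)]
    -- The primitive x + 2·`sineSum` changes by at most 2π + 4(1 + π) = 6π + 4, which is below 8π.
    -- Division by 2π gives the constant 4.
    have hk : ∀ r, |∫ t in a..b, dirichletSum n (t - r)| ≤ 8 * Real.pi := by
      intro r
      rw [intervalIntegral.integral_eq_sub_of_hasDerivAt
        (fun t _ => (hasDerivAt_sineSum n (t - r)).comp_sub_const t r)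
        (Continuous.intervalIntegrable (by fun_prop) _ _)]
      have h1 := abs_sineSum_le n (b - r)
      have h2 := abs_sineSum_le n (a - r)
      have h3 := Real.pi_gt_three
      rw [abs_le] at *
      obtain ⟨ha1, ha2⟩ := ha
      obtain ⟨hb1, hb2⟩ := hb
      constructor <;> linarith [h1.1, h1.2, h2.1, h2.2]
    have c : Continuous fun r => ∫ t in a..b, g r * dirichletSum n (t - r) :=
      intervalIntegral.continuous_parametric_intervalIntegral_of_continuous' (by fun_prop) _ _
    have h1 : |circInt (fun r => ∫ t in a..b, g r * dirichletSum n (t - r))| ≤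
        circInt (fun r => 8 * Real.pi * |g r|) := by
      refine abs_circInt_le c (by fun_prop) fun r => ?_
      rw [intervalIntegral.integral_const_mul, abs_mul, mul_comm]
      exact mul_le_mul_of_nonneg_right (hk r) (abs_nonneg _)
    rw [circInt_const_mul] at h1
    calc _ ≤ (2 * Real.pi)⁻¹ * (8 * Real.pi * circInt (fun t => |g t|)) := by gcongr
      _ = _ := by field_simp; ring

/-! ### Bounded solutions of a linear fourth-order equation -/

/-- Boundedness of a complex-valued function on the line. -/
def IsBoundedFun (f : ℝ → ℂ) : Prop := ∃ M : ℝ, ∀ x, ‖f x‖ ≤ M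

/-- The forward difference with step one. -/
def stepDiff (f : ℝ → ℂ) (x : ℝ) : ℂ := f (x + 1) - f x

lemma IsBoundedFun.add {f g : ℝ → ℂ} (hf : IsBoundedFun f) (hg : IsBoundedFun g) :
    IsBoundedFun fun x => f x + g x :=
  let ⟨M, hM⟩ := hf
  let ⟨M', hM'⟩ := hg
  ⟨M + M', fun x => (norm_add_le _ _).trans (add_le_add (hM x) (hM' x))⟩

lemma IsBoundedFun.const_mul {f : ℝ → ℂ} (hf : IsBoundedFun f) (c : ℂ) :
    IsBoundedFun fun x => c * f x :=
  let ⟨M, hM⟩ := hf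
  ⟨‖c‖ * M, fun x => by rw [norm_mul]; gcongr; exact hM x⟩

lemma IsBoundedFun.stepDiff {f : ℝ → ℂ} (hf : IsBoundedFun f) : IsBoundedFun (stepDiff f) :=
  let ⟨M, hM⟩ := hf
  ⟨M + M, fun _ => (norm_sub_le _ _).trans (add_le_add (hM _) (hM _))⟩

lemma hasDerivAt_stepDiff {f f' : ℝ → ℂ} (h : ∀ x, HasDerivAt f (f' x) x) (x : ℝ) :
    HasDerivAt (stepDiff f) (stepDiff f' x) x :=
  ((h (x + 1)).comp_add_const x 1).sub (h x)

lemma hasDerivAt_cexp_mul (μ : ℂ) (x : ℝ) :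
    HasDerivAt (fun y : ℝ => Complex.exp (μ * y)) (μ * Complex.exp (μ * x)) x := by
  have h := (((hasDerivAt_id (x : ℂ)).const_mul μ).cexp).comp_ofReal
  simpa [mul_comm] using h

/-- If `G' = C e^{μx} + H` with `H` bounded, then the step difference of `G` equals the one of
`C e^{μx} / μ` up to a bounded function. -/
lemma isBoundedFun_stepDiff_sub {G H : ℝ → ℂ} {C μ : ℂ} (hμ : μ ≠ 0)
    (hG : ∀ x : ℝ, HasDerivAt G (C * Complex.exp (μ * x) + H x) x) (hH : IsBoundedFun H) :
    IsBoundedFun fun x => stepDiff G x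
      + -(C * ((Complex.exp μ - 1) / μ)) * Complex.exp (μ * x) := by
  obtain ⟨M, hM⟩ := hH
  refine ⟨M, fun x => ?_⟩
  have hd : ∀ y : ℝ, HasDerivAt (fun y : ℝ => G y - C / μ * Complex.exp (μ * y)) (H y) y := by
    intro y
    refine ((hG y).sub ((hasDerivAt_cexp_mul μ y).const_mul (C / μ))).congr_deriv ?_
    field_simp
    ring
  have h := Convex.norm_image_sub_le_of_norm_hasDerivWithin_le (s := Set.univ)
    (fun y _ => (hd y).hasDerivWithinAt) (fun y _ => hM y) convex_univ
    (Set.mem_univ x) (Set.mem_univ (x + 1))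
  simp only [add_sub_cancel_left, norm_one, mul_one] at h
  refine le_of_eq_of_le (congrArg norm ?_) h
  have e : Complex.exp (μ * (x + 1 : ℝ)) = Complex.exp (μ * x) * Complex.exp μ := by
    rw [← Complex.exp_add]; push_cast; congr 1; ring
  simp only [stepDiff]
  rw [e]
  field_simp
  ring

lemma eq_zero_of_isBoundedFun_cexp {C μ : ℂ} (hμ : μ.re ≠ 0)
    (h : IsBoundedFun fun x : ℝ => C * Complex.exp (μ * x)) : C = 0 := by
  obtain ⟨M, hM⟩ := h
  by_contra hC
  have hC' : 0 < ‖C‖ := norm_pos_iff.2 hC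
  -- At this point the exponential has modulus exp(M/‖C‖) ≥ 1 + M/‖C‖, which exceeds the bound.
  -- Dividing by the real part handles growth at either end of the line.
  have h1 := hM (M / ‖C‖ / μ.re)
  rw [norm_mul, Complex.norm_exp] at h1
  have e : (μ * ((M / ‖C‖ / μ.re : ℝ) : ℂ)).re = M / ‖C‖ := by
    rw [Complex.re_mul_ofReal]
    field_simp
  rw [e] at h1
  have h2 := Real.add_one_le_exp (M / ‖C‖)
  have h3 : ‖C‖ * (M / ‖C‖ + 1) ≤ M := (mul_le_mul_of_nonneg_left h2 hC'.le).trans h1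
  have h4 : ‖C‖ * (M / ‖C‖ + 1) = M + ‖C‖ := by field_simp
  linarith

section LinearODE

variable {y a b c : ℝ → ℂ} {s κ : ℂ}

/-- For a bounded solution of `y'''' = s y' - κ y`, the component along a characteristic root off
the imaginary axis vanishes. -/
lemma root_component_eq_zero (hy : ∀ x, HasDerivAt y (a x) x) (ha : ∀ x, HasDerivAt a (b x) x)
    (hb : ∀ x, HasDerivAt b (c x) x) (hc : ∀ x, HasDerivAt c (s * a x - κ * y x) x)
    (hbd : IsBoundedFun y) {μ : ℂ} (hroot : μ ^ 4 - s * μ + κ = 0) (hre : μ.re ≠ 0) (x : ℝ) :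
    c x + μ * b x + μ ^ 2 * a x + (μ ^ 3 - s) * y x = 0 := by
  have hμ : μ ≠ 0 := fun h => hre (by simp [h])
  -- f is the quotient of the characteristic polynomial by X - μ, as a differential operator applied
  -- to y; hence f' = μf.
  set f : ℝ → ℂ := fun x => c x + μ * b x + μ ^ 2 * a x + (μ ^ 3 - s) * y x with hf
  have df : ∀ x, HasDerivAt f (μ * f x) x := by
    intro x
    refine ((((hc x).add ((hb x).const_mul μ)).add ((ha x).const_mul (μ ^ 2))).add
      ((hy x).const_mul (μ ^ 3 - s))).congr_deriv ?_
    simp only [hf]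
    linear_combination (-y x) * hroot
  obtain ⟨C, hC⟩ : ∃ C, ∀ x : ℝ, f x = C * Complex.exp (μ * x) := by
    refine ⟨f 0, fun x => ?_⟩
    have hd : ∀ x : ℝ, HasDerivAt (fun x : ℝ => f x * Complex.exp (-μ * x)) 0 x := by
      intro x
      refine ((df x).mul (hasDerivAt_cexp_mul (-μ) x)).congr_deriv ?_
      ring
    have h := is_const_of_deriv_eq_zero (fun x => (hd x).differentiableAt)
      (fun x => (hd x).deriv) x 0
    simp only [Complex.ofReal_zero, mul_zero, Complex.exp_zero, mul_one] at h
    rw [← h, mul_assoc, ← Complex.exp_add]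
    simp
  -- k is the factor by which integrating over a unit step multiplies e^{μx}. It is nonzero because
  -- |e^μ| ≠ 1 off the imaginary axis.
  set k := (Complex.exp μ - 1) / μ with hk
  have hk0 : k ≠ 0 := by
    refine div_ne_zero (sub_ne_zero.2 fun h => hre ?_) hμ
    have := congrArg (‖·‖) h
    simpa [Complex.norm_exp] using this
  -- Only y is known to be bounded, not its derivatives. Each step difference trades one derivative
  -- for a bounded error and a factor k, so after three of them Ck³e^{μx} is bounded.
  have b1 := isBoundedFun_stepDiff_sub (C := C) hμ
    (G := fun x => b x + μ * a x + μ ^ 2 * y x) (H := fun x => -(μ ^ 3 - s) * y x)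
    (fun x => by
      refine (((hb x).add ((ha x).const_mul μ)).add ((hy x).const_mul (μ ^ 2))).congr_deriv ?_
      rw [← hC]; simp only [hf]; ring) (hbd.const_mul _)
  have b2 := isBoundedFun_stepDiff_sub (C := C * k) hμ
    (G := stepDiff fun x => a x + μ * y x)
    (fun x => by
      refine (hasDerivAt_stepDiff (fun x => (ha x).add ((hy x).const_mul μ)) x).congr_deriv ?_
      have : stepDiff (fun x => b x + μ * a x) x = C * k * Complex.exp (μ * x) +
        ((stepDiff (fun x => b x + μ * a x + μ ^ 2 * y x) x +
          -(C * ((Complex.exp μ - 1) / μ)) * Complex.exp (μ * x)) + -μ ^ 2 * stepDiff y x) := by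
        simp only [stepDiff, hk]; ring
      exact this) (b1.add (hbd.stepDiff.const_mul (-μ ^ 2)))
  have b3 := isBoundedFun_stepDiff_sub (C := C * k * k) hμ
    (G := stepDiff (stepDiff y))
    (fun x => by
      refine (hasDerivAt_stepDiff (hasDerivAt_stepDiff hy) x).congr_deriv ?_
      have : stepDiff (stepDiff a) x = C * k * k * Complex.exp (μ * x) +
        ((stepDiff (stepDiff fun x => a x + μ * y x) x +
          -(C * k * ((Complex.exp μ - 1) / μ)) * Complex.exp (μ * x))
          + -μ * stepDiff (stepDiff y) x) := by
        simp only [stepDiff, hk]; ring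
      exact this) (b2.add (hbd.stepDiff.stepDiff.const_mul (-μ)))
  have b4 : IsBoundedFun fun x : ℝ => C * k * k * k * Complex.exp (μ * x) := by
    have := (b3.add (hbd.stepDiff.stepDiff.stepDiff.const_mul (-1))).const_mul (-1)
    convert this using 2
    simp only [hk]
    ring
  have hC0 : C = 0 := by simpa [hk0] using eq_zero_of_isBoundedFun_cexp hre b4
  have := hC x
  rw [hC0, zero_mul] at this
  exact this

/-- Bounded solutions of `y'''' = s y' - κ y` vanish if the characteristic roots are simple and off
the imaginary axis. -/
lemma bounded_solution_eq_zero (hy : ∀ x, HasDerivAt y (a x) x)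
    (ha : ∀ x, HasDerivAt a (b x) x) (hb : ∀ x, HasDerivAt b (c x) x)
    (hc : ∀ x, HasDerivAt c (s * a x - κ * y x) x) (hbd : IsBoundedFun y)
    (hroots : ∀ μ : ℂ, μ ^ 4 - s * μ + κ = 0 → μ.re ≠ 0 ∧ 4 * μ ^ 3 - s ≠ 0) (x : ℝ) :
    y x = 0 ∧ a x = 0 ∧ b x = 0 ∧ c x = 0 := by
  open Polynomial in
  set p : ℂ[X] := X ^ 4 - C s * X + C κ with hp
  -- For fixed x the vanishing root components say that this cubic in μ has the four distinct
  -- characteristic roots as zeros, so all its coefficients vanish.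
  set r : ℂ[X] := C (y x) * X ^ 3 + C (a x) * X ^ 2 + C (b x) * X + C (c x - s * y x) with hr
  have hdeg : p.natDegree = 4 := by rw [hp]; compute_degree!
  have hp0 : p ≠ 0 := fun h => by simp [h] at hdeg
  have hroot : ∀ μ ∈ p.roots, μ ^ 4 - s * μ + κ = 0 := by
    intro μ hμ
    have := (Polynomial.mem_roots hp0).1 hμ
    simpa [hp] using this
  have hcard : p.roots.card = 4 := by
    rw [← hdeg]
    exact (Polynomial.splits_iff_card_roots).1 (IsAlgClosed.splits p)
  have hnodup : p.roots.Nodup := by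
    rw [Multiset.nodup_iff_count_le_one]
    intro μ
    rw [Polynomial.count_roots]
    by_contra h
    have h1 := (Polynomial.one_lt_rootMultiplicity_iff_isRoot hp0).1 (not_le.1 h)
    refine (hroots μ (hroot μ ((Polynomial.mem_roots hp0).2 h1.1))).2 ?_
    have h2 := h1.2
    simp [hp] at h2
    linear_combination h2
  have hr0 : r = 0 := by
    by_contra hr0
    have hsub : p.roots ≤ r.roots := by
      rw [Multiset.le_iff_subset hnodup]
      intro μ hμ
      rw [Polynomial.mem_roots hr0]
      have h1 := root_component_eq_zero hy ha hb hc hbd (hroot μ hμ) (hroots μ (hroot μ hμ)).1 x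
      simp only [hr, Polynomial.IsRoot, Polynomial.eval_add, Polynomial.eval_mul,
        Polynomial.eval_C, Polynomial.eval_pow, Polynomial.eval_X]
      linear_combination h1
    have h1 := Multiset.card_le_card hsub
    have h2 := Polynomial.card_roots' r
    have h3 : r.natDegree ≤ 3 := by rw [hr]; compute_degree
    omega
  have h3 := congrArg (Polynomial.coeff · 3) hr0
  have h2 := congrArg (Polynomial.coeff · 2) hr0
  have h1 := congrArg (Polynomial.coeff · 1) hr0
  have h0 := congrArg (Polynomial.coeff · 0) hr0
  simp [hr, Polynomial.coeff_X, Polynomial.coeff_C] at h3 h2 h1 h0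
  rw [h3] at h0
  exact ⟨h3, h2, h1, by simpa using h0⟩

end LinearODE

/-- For μ = it the equation reads t⁴ + i(ωl - st) = 0, forcing t = 0 and then ωl = 0. At a double
root, 4μ³ = s gives 3sμ = 4iωl, so μ would be imaginary, which was just excluded. -/
lemma characteristic_roots {s ω : ℝ} (hs : s ≠ 0) (hω : ω ≠ 0) {l : ℤ} (hl : l ≠ 0) {μ : ℂ}
    (h : μ ^ 4 - s * μ + ω * (Complex.I * l) = 0) : μ.re ≠ 0 ∧ 4 * μ ^ 3 - s ≠ 0 := by
  have hl' : (l : ℝ) ≠ 0 := by exact_mod_cast hl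
  have key : μ.re ≠ 0 := by
    intro hre
    obtain ⟨t, rfl⟩ : ∃ t : ℝ, μ = t * Complex.I := ⟨μ.im, by
      apply Complex.ext <;> simp [hre]⟩
    have e : (t * Complex.I) ^ 4 - s * (t * Complex.I) + ω * (Complex.I * l) =
        ((t ^ 4 : ℝ) : ℂ) + ((ω * l - s * t : ℝ) : ℂ) * Complex.I := by
      rw [mul_pow, Complex.I_pow_four]; push_cast; ring
    rw [e] at h
    have h1 := congrArg Complex.re h
    have h2 := congrArg Complex.im h
    simp only [Complex.add_re, Complex.ofReal_re, Complex.re_ofReal_mul, Complex.I_re, mul_zero,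
      add_zero, Complex.zero_re] at h1
    simp only [Complex.add_im, Complex.ofReal_im, Complex.im_ofReal_mul, Complex.I_im, mul_one,
      zero_add, Complex.zero_im] at h2
    have ht : t = 0 := by simpa using h1
    rw [ht, mul_zero, sub_zero] at h2
    exact mul_ne_zero hω hl' h2
  refine ⟨key, fun h' => key ?_⟩
  have h1 : (3 * s : ℝ) * μ = ((4 * ω * l : ℝ) : ℂ) * Complex.I := by
    push_cast
    linear_combination (-4 : ℂ) * h + μ * h'
  have h2 := congrArg Complex.re h1
  simp only [Complex.re_ofReal_mul, Complex.I_re, mul_zero] at h2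
  simpa [hs] using h2

/-! ### Fourier modes -/

lemma intervalIntegrable_mode {f : ℝ → ℝ} (hf : Continuous f) (l : ℤ) (a b : ℝ) :
    IntervalIntegrable (fun t => (f t : ℂ) * Complex.exp (-(Complex.I * l * t))) volume a b :=
  Continuous.intervalIntegrable (by fun_prop) _ _

lemma fourierMode_add {f g : ℝ → ℝ} (hf : Continuous f) (hg : Continuous g) (l : ℤ) :
    fourierMode (fun t => f t + g t) l = fourierMode f l + fourierMode g l := by
  simp only [fourierMode, Complex.ofReal_add, add_mul]
  rw [intervalIntegral.integral_add (intervalIntegrable_mode hf l _ _)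
    (intervalIntegrable_mode hg l _ _), mul_add]

lemma fourierMode_const_mul (c : ℝ) (f : ℝ → ℝ) (l : ℤ) :
    fourierMode (fun t => c * f t) l = c * fourierMode f l := by
  simp only [fourierMode, Complex.ofReal_mul, mul_assoc (c : ℂ)]
  rw [intervalIntegral.integral_const_mul]
  ring

lemma fourierMode_sub {f g : ℝ → ℝ} (hf : Continuous f) (hg : Continuous g) (l : ℤ) :
    fourierMode (fun t => f t - g t) l = fourierMode f l - fourierMode g l := by
  simp only [fourierMode, Complex.ofReal_sub, sub_mul]
  rw [intervalIntegral.integral_sub (intervalIntegrable_mode hf l _ _)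
    (intervalIntegrable_mode hg l _ _), mul_sub]

lemma hasDerivAt_fourierMode {F F' : ℝ → ℝ → ℝ} (hF : ∀ x, Continuous (F x))
    (hF' : Continuous (uncurry F')) (h : ∀ x t, HasDerivAt (fun y => F y t) (F' x t) x)
    (l : ℤ) (x : ℝ) :
    HasDerivAt (fun y => fourierMode (F y) l) (fourierMode (F' x) l) x := by
  refine HasDerivAt.const_mul _ (hasDerivAt_integral_of_continuous
    (F := fun y t => (F y t : ℂ) * Complex.exp (-(Complex.I * l * t)))
    (F' := fun y t => (F' y t : ℂ) * Complex.exp (-(Complex.I * l * t)))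
    (fun x => ?_) (by fun_prop) (fun x t => ((h x t).ofReal_comp).mul_const _) _ _ x)
  have := hF x
  fun_prop

lemma hasDerivAt_cexp_I_mul (l : ℤ) (t : ℝ) :
    HasDerivAt (fun t : ℝ => Complex.exp (-(Complex.I * l * t)))
      (-(Complex.I * l) * Complex.exp (-(Complex.I * l * t))) t := by
  simpa only [neg_mul] using hasDerivAt_cexp_mul (-(Complex.I * l)) t

lemma cexp_two_pi (l : ℤ) : Complex.exp (-(Complex.I * l * ((2 * Real.pi : ℝ) : ℂ))) = 1 := by
  rw [Complex.exp_eq_one_iff]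
  exact ⟨-l, by push_cast; ring⟩

lemma fourierMode_deriv {f f' : ℝ → ℝ} (h : ∀ t, HasDerivAt f (f' t) t) (hf' : Continuous f')
    (hp : f (2 * Real.pi) = f 0) (l : ℤ) :
    fourierMode f' l = Complex.I * l * fourierMode f l := by
  have key := intervalIntegral.integral_mul_deriv_eq_deriv_mul (a := 0) (b := 2 * Real.pi)
    (v := fun t => (f t : ℂ)) (v' := fun t => (f' t : ℂ))
    (fun t _ => hasDerivAt_cexp_I_mul l t) (fun t _ => (h t).ofReal_comp)
    (Continuous.intervalIntegrable (by fun_prop) _ _)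
    (Continuous.intervalIntegrable (by fun_prop) _ _)
  rw [cexp_two_pi, hp] at key
  simp only [Complex.ofReal_zero, mul_zero, neg_zero, Complex.exp_zero, sub_self, zero_sub,
    mul_assoc (-(Complex.I * l)), intervalIntegral.integral_const_mul] at key
  simp only [fourierMode, mul_comm (Complex.ofReal _)]
  rw [key]
  ring

lemma fourierMode_one {l : ℤ} (hl : l ≠ 0) : fourierMode (fun _ => 1) l = 0 := by
  have h := fourierMode_deriv (f := fun _ => (1 : ℝ)) (fun t => hasDerivAt_const t 1)
    continuous_const rfl l
  have h0 : fourierMode (fun _ => (0 : ℝ)) l = 0 := by simp [fourierMode]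
  rw [h0] at h
  have : (l : ℂ) ≠ 0 := by exact_mod_cast hl
  simpa [this] using h.symm

lemma integral_cexp_eq_zero {l : ℤ} (hl : l ≠ 0) :
    ∫ t in (0 : ℝ)..(2 * Real.pi), Complex.exp (-(Complex.I * l * t)) = 0 := by
  have h := fourierMode_one hl
  have hpi : (Real.pi : ℂ) ≠ 0 := by exact_mod_cast Real.pi_ne_zero
  simpa [fourierMode, hpi] using h

lemma fourierMode_galerkin_eq_zero (n : ℕ) (f : ℝ → ℝ) {l : ℤ} (hl : (n : ℤ) < |l|) :
    fourierMode (galerkin n f) l = 0 := by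
  unfold fourierMode
  simp only [galerkin_coe, fourierSum, Finset.sum_mul]
  rw [intervalIntegral.integral_finsetSum
    (fun j _ => Continuous.intervalIntegrable (by fun_prop) _ _), Finset.sum_eq_zero, mul_zero]
  intro j hj
  have hjl : l - j ≠ 0 := by
    rw [Finset.mem_Icc] at hj
    intro h
    have : l = j := by omega
    rw [this, lt_abs] at hl
    omega
  have e : ∀ t : ℝ, fourierMode f j * Complex.exp (Complex.I * j * t)
      * Complex.exp (-(Complex.I * l * t)) =
      fourierMode f j * Complex.exp (-(Complex.I * ((l - j : ℤ) : ℂ) * t)) := by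
    intro t
    rw [mul_assoc, ← Complex.exp_add]
    congr 2; push_cast; ring
  simp only [e]
  rw [intervalIntegral.integral_const_mul, integral_cexp_eq_zero hjl, mul_zero]

/-- A continuous periodic function without modes above `n` is its own Galerkin projection. -/
lemma galerkin_eq_self (n : ℕ) {f : ℝ → ℝ} (hf : Continuous f) (hp : Periodic f (2 * Real.pi))
    (h : ∀ l : ℤ, (n : ℤ) < |l| → fourierMode f l = 0) : galerkin n f = f := by
  have : Fact (0 < 2 * Real.pi) := ⟨Real.two_pi_pos⟩
  have hpc : Periodic (fun t => (f t : ℂ)) (2 * Real.pi) := fun t => by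
    simp only [hp t]
  let g : C(AddCircle (2 * Real.pi), ℂ) :=
    ⟨hpc.lift, continuous_coinduced_dom.2 (by exact Complex.continuous_ofReal.comp hf)⟩
  have hpi : (Real.pi : ℂ) ≠ 0 := by exact_mod_cast Real.pi_ne_zero
  have hexp : ∀ (l : ℤ) (t : ℝ), fourier l (t : AddCircle (2 * Real.pi)) =
      Complex.exp (Complex.I * l * t) := by
    intro l t
    rw [fourier_coe_apply]
    congr 1
    push_cast
    field_simp
  have hcoeff : ∀ l, fourierCoeff g l = fourierMode f l := by
    intro l
    rw [fourierCoeff_eq_intervalIntegral g l 0, zero_add, fourierMode, Complex.real_smul]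
    push_cast
    rw [one_div]
    congr 2; ext t
    rw [hexp, smul_eq_mul, mul_comm]
    congr 1
    push_cast
    congr 1; ring
  have hzero : ∀ l ∉ Finset.Icc (-(n : ℤ)) (n : ℤ), fourierCoeff g l = 0 := by
    intro l hl
    rw [hcoeff]
    refine h l ?_
    rw [Finset.mem_Icc] at hl
    rw [lt_abs]
    omega
  ext t
  -- With finitely many nonzero coefficients the Fourier series is summable, hence converges
  -- pointwise to the continuous function, and it is the finite symmetric sum.
  have hsum : Summable (fourierCoeff g) := summable_of_ne_finset_zero hzero
  have h1 := has_pointwise_sum_fourier_series_of_summable hsum (t : AddCircle (2 * Real.pi))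
  have h2 := hasSum_sum_of_ne_finset_zero (L := SummationFilter.unconditional ℤ) (f := fun l : ℤ => fourierCoeff g l •
    fourier l (t : AddCircle (2 * Real.pi))) (s := Finset.Icc (-(n : ℤ)) (n : ℤ))
    (fun l hl => by rw [hzero l hl, zero_smul])
  have h3 := h1.unique h2
  have h4 : g (t : AddCircle (2 * Real.pi)) = (f t : ℂ) := rfl
  simp only [hcoeff, hexp, smul_eq_mul, h4] at h3
  have h5 := galerkin_coe n f t
  rw [fourierSum, ← h3] at h5
  exact_mod_cast h5

lemma galerkin_one (n : ℕ∞) : galerkin n (fun _ => 1) = fun _ => 1 := by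
  cases n with
  | top => rfl
  | coe n =>
    refine galerkin_eq_self n continuous_const (fun _ => rfl) fun l hl => fourierMode_one ?_
    rintro rfl
    simp at hl
    omega

lemma circInt_galerkin (n : ℕ∞) {f : ℝ → ℝ} (hf : Continuous f) :
    circInt (galerkin n f) = circInt f := by
  have h := circInt_galerkin_mul n hf (continuous_const (y := (1 : ℝ)))
  rw [galerkin_one] at h
  simpa using h

/-! ### From modulated waves to wave profiles -/

lemma exists_partial_fst {F : ℝ → ℝ → ℝ} (hF : ContDiff ℝ (⊤ : ℕ∞) (uncurry F)) :
    ∃ G : ℝ → ℝ → ℝ, ContDiff ℝ (⊤ : ℕ∞) (uncurry G) ∧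
      ∀ x t, HasDerivAt (fun y => F y t) (G x t) x := by
  refine ⟨fun x t => fderiv ℝ (uncurry F) (x, t) (1, 0), ?_, fun x t => ?_⟩
  · exact (hF.fderiv_right (m := (⊤ : ℕ∞)) (by simp)).clm_apply contDiff_const
  · exact ((hF.differentiable (by simp)) (x, t)).hasFDerivAt.comp_hasDerivAt x
      ((hasDerivAt_id x).prodMk (hasDerivAt_const x t))

lemma exists_partial_snd {F : ℝ → ℝ → ℝ} (hF : ContDiff ℝ (⊤ : ℕ∞) (uncurry F)) :
    ∃ G : ℝ → ℝ → ℝ, ContDiff ℝ (⊤ : ℕ∞) (uncurry G) ∧ ∀ x t, HasDerivAt (F x) (G x t) t := by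
  refine ⟨fun x t => fderiv ℝ (uncurry F) (x, t) (0, 1), ?_, fun x t => ?_⟩
  · exact (hF.fderiv_right (m := (⊤ : ℕ∞)) (by simp)).clm_apply contDiff_const
  · exact ((hF.differentiable (by simp)) (x, t)).hasFDerivAt.comp_hasDerivAt t
      ((hasDerivAt_const t x).prodMk (hasDerivAt_id t))

lemma periodic_of_hasDerivAt {F G : ℝ → ℝ → ℝ} {T : ℝ} (hF : ∀ x, Periodic (F x) T)
    (h : ∀ x t, HasDerivAt (fun y => F y t) (G x t) x) (x : ℝ) : Periodic (G x) T := by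
  intro t
  refine (h x (t + T)).unique ?_
  have : (fun y => F y (t + T)) = fun y => F y t := funext fun y => hF y t
  rw [this]
  exact h x t

lemma norm_fourierMode_le {f : ℝ → ℝ} {M : ℝ} (hM : ∀ t, |f t| ≤ M) (l : ℤ) :
    ‖fourierMode f l‖ ≤ M := by
  have h := intervalIntegral.norm_integral_le_of_norm_le_const (a := 0) (b := 2 * Real.pi) (C := M)
    (f := fun t => (f t : ℂ) * Complex.exp (-(Complex.I * l * t))) (fun t _ => by
      rw [norm_mul, Complex.norm_exp]
      simpa using hM t)
  rw [sub_zero, abs_of_pos Real.two_pi_pos] at h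
  have e : (2 * Real.pi : ℂ)⁻¹ = ((2 * Real.pi)⁻¹ : ℝ) := by push_cast; rfl
  rw [fourierMode, e, norm_mul, Complex.norm_real, Real.norm_of_nonneg (by positivity)]
  calc _ ≤ (2 * Real.pi)⁻¹ * (M * (2 * Real.pi)) := by gcongr
    _ = M := by field_simp

namespace IsModulatedWave

variable {n : ℕ∞} {s ω : ℝ} {u v θ w : ℝ → ℝ → ℝ}

/-- The modes of a bounded wave above the truncation index vanish. -/
lemma fourierMode_eq_zero {k : ℕ} {u' : ℝ → ℝ → ℝ} (h : IsModulatedWave k s ω u v θ w)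
    (hs : s ≠ 0) (hω : ω ≠ 0)
    (hu : Continuous (uncurry u)) (hv : Continuous (uncurry v)) (hθ : Continuous (uncurry θ))
    (hw : Continuous (uncurry w)) (hu' : Continuous (uncurry u'))
    (hut : ∀ x t, HasDerivAt (u x) (u' x t) t) (hbd : ∃ M : ℝ, ∀ x t, |u x t| ≤ M)
    {l : ℤ} (hl : (k : ℤ) < |l|) (x : ℝ) :
    fourierMode (u x) l = 0 ∧ fourierMode (w x) l = 0 := by
  have hl0 : l ≠ 0 := by rintro rfl; simp at hl; omega
  obtain ⟨q, hq⟩ : ∃ q : ℝ → ℝ → ℝ, q = fun x => galerkin k (fun t => potentialDeriv (u x t)) :=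
    ⟨_, rfl⟩
  have cq : Continuous (uncurry q) := by
    rw [hq]
    exact continuous_galerkin k (by unfold potentialDeriv; fun_prop)
  have v_eq : ∀ x t, HasDerivAt (fun y => v y t) (q x t + θ x t) x := by
    rw [hq]
    exact h.v_eq
  have dy := hasDerivAt_fourierMode (fun x => by fun_prop) hv h.u_eq l
  have da := hasDerivAt_fourierMode (fun x => by fun_prop) (F := v)
    (F' := fun x t => q x t + θ x t) (by fun_prop) v_eq l
  have db := hasDerivAt_fourierMode (fun x => by fun_prop) hw h.θ_eq l
  have dc := hasDerivAt_fourierMode (fun x => by fun_prop) (F := w)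
    (F' := fun x t => s * v x t - ω * u' x t) (by fun_prop)
    (fun x t => by rw [← (hut x t).deriv]; exact h.w_eq x t) l
  -- Above the truncation index the projected nonlinearity has no mode, so the system for this mode
  -- is linear: y'''' = s y' - iωl y.
  have ea : ∀ x, fourierMode (fun t => q x t + θ x t) l = fourierMode (θ x) l := by
    intro x
    rw [fourierMode_add (by fun_prop) (by fun_prop), hq, fourierMode_galerkin_eq_zero k _ hl,
      zero_add]
  have ec : ∀ x, fourierMode (fun t => s * v x t - ω * u' x t) l =
      s * fourierMode (v x) l - ω * (Complex.I * l) * fourierMode (u x) l := by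
    intro x
    rw [fourierMode_sub (by fun_prop) (by fun_prop), fourierMode_const_mul, fourierMode_const_mul,
      fourierMode_deriv (hut x) (by fun_prop) (by simpa using h.periodic x 0)]
    ring
  simp only [ea] at da
  simp only [ec] at dc
  obtain ⟨M, hM⟩ := hbd
  have := bounded_solution_eq_zero dy da db dc ⟨M, fun x => norm_fourierMode_le (hM x) l⟩
    (fun μ hμ => characteristic_roots hs hω hl0 hμ) x
  exact ⟨this.1, this.2.2.2⟩

/-- Bounded smooth modulated waves have all the regularity needed for the energy estimates. -/
theorem exists_profile (h : IsModulatedWave n s ω u v θ w) (hs : s ≠ 0) (hω : ω ≠ 0)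
    (hsm : ContDiff ℝ (⊤ : ℕ∞) (uncurry u)) (hbd : ∃ M : ℝ, ∀ x t, |u x t| ≤ M) (ξ : ℝ) :
    ∃ Z q, WaveProfile s ω (firstIntegral s u w ξ) 4 u v θ w Z q := by
  obtain ⟨u₁, hu₁, du₁⟩ := exists_partial_fst hsm
  obtain rfl : v = u₁ := funext fun x => funext fun t => (h.u_eq x t).unique (du₁ x t)
  obtain ⟨u₂, hu₂, du₂⟩ := exists_partial_fst hu₁
  obtain ⟨u₃, hu₃, du₃⟩ := exists_partial_fst hu₂
  obtain ⟨u', hu', du'⟩ := exists_partial_snd hsm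
  have cu := hsm.continuous
  have cv := hu₁.continuous
  have cu₂ := hu₂.continuous
  have cu₃ := hu₃.continuous
  have cu' := hu'.continuous
  set q : ℝ → ℝ → ℝ := fun x => galerkin n (fun t => u x t ^ 3 - u x t) with hq
  have cq : Continuous (uncurry q) := continuous_galerkin n (by fun_prop)
  have pot : ∀ x, (fun t => potentialDeriv (u x t)) = fun t => u x t ^ 3 - u x t := by
    intro x; ext t; simp only [potentialDeriv]; ring
  have v_eq : ∀ x t, HasDerivAt (fun y => v y t) (q x t + θ x t) x := by
    intro x t
    have := h.v_eq x t
    rwa [pot] at this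
  -- The regularity of θ and w is not assumed; it is recovered from that of u through θ = u_ξξ - q
  -- and w = θ_ξ.
  have θ_def : θ = fun x t => u₂ x t - q x t := by
    ext x t
    linarith [(v_eq x t).unique (du₂ x t)]
  have cθ : Continuous (uncurry θ) := by rw [θ_def]; fun_prop
  have dq : ∀ x t, HasDerivAt (fun y => q y t)
      (galerkin n (fun t => 3 * u x t ^ 2 * v x t - v x t) t) x := by
    refine hasDerivAt_galerkin n (F := fun x t => u x t ^ 3 - u x t) (fun x => by fun_prop)
      (F' := fun x t => 3 * u x t ^ 2 * v x t - v x t) (by fun_prop) fun x t => ?_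
    exact (((h.u_eq x t).pow 3).sub (h.u_eq x t)).congr_deriv (by norm_num)
  have cq' : Continuous (uncurry fun x => galerkin n (fun t => 3 * u x t ^ 2 * v x t - v x t)) :=
    continuous_galerkin n (by fun_prop)
  have w_def : w = fun x t => u₃ x t - galerkin n (fun t => 3 * u x t ^ 2 * v x t - v x t) t := by
    ext x t
    refine (h.θ_eq x t).unique ?_
    rw [θ_def]
    exact (du₃ x t).sub (dq x t)
  have cw : Continuous (uncurry w) := by rw [w_def]; fun_prop
  have dz : ∀ I x t, HasDerivAt (fun y => w y t - s * u y t - I) (-ω * u' x t) x := by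
    intro I x t
    refine (((h.w_eq x t).sub ((h.u_eq x t).const_mul s)).sub_const I).congr_deriv ?_
    rw [(du' x t).deriv]
    ring
  have int_u' : ∀ x a b, ∫ t in a..b, -ω * u' x t = -ω * (u x b - u x a) := by
    intro x a b
    rw [intervalIntegral.integral_const_mul, intervalIntegral.integral_eq_sub_of_hasDerivAt
      (fun t _ => du' x t) (Continuous.intervalIntegrable (by fun_prop) _ _)]
  have per_u : ∀ x, u x (2 * Real.pi) = u x 0 := fun x => by simpa using h.periodic x 0
  set I := firstIntegral s u w ξ with hI
  -- The ξ-derivative of w - su - I is -ωu_τ, which integrates to zero over a period. The mean is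
  -- thus constant in ξ, and it vanishes at the point where I is evaluated.
  have z_int : ∀ x, circInt (fun t => w x t - s * u x t - I) = 0 := by
    intro x
    have d : ∀ x, HasDerivAt (fun y => circInt (fun t => w y t - s * u y t - I)) 0 x := by
      intro x
      refine (hasDerivAt_circInt (fun x => by fun_prop) (F' := fun x t => -ω * u' x t)
        (by fun_prop) (dz I) x).congr_deriv ?_
      rw [circInt, int_u', per_u]
      ring
    have e := is_const_of_deriv_eq_zero (fun x => (d x).differentiableAt) (fun x => (d x).deriv) x ξ
    rw [e, circInt_sub (by fun_prop) (by fun_prop), circInt_const, hI, firstIntegral,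
      interval_average_eq, circInt, sub_zero, smul_eq_mul]
    field_simp
    simp
  obtain ⟨z, hz⟩ : ∃ z : ℝ → ℝ → ℝ, z = fun x t => w x t - s * u x t - I := ⟨_, rfl⟩
  have cz : Continuous (uncurry z) := by rw [hz]; fun_prop
  have dz' : ∀ x t, HasDerivAt (fun y => z y t) (-ω * u' x t) x := by rw [hz]; exact dz I
  have z_int' : ∀ x, circInt (z x) = 0 := by rw [hz]; exact z_int
  set P : ℝ → ℝ → ℝ := fun x t => ∫ r in (0 : ℝ)..t, z x r with hP
  have cP : Continuous (uncurry P) :=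
    intervalIntegral.continuous_parametric_primitive_of_continuous cz
  have dPt : ∀ x t, HasDerivAt (P x) (z x t) t := by
    intro x t
    exact ((by fun_prop : Continuous (z x)).integral_hasStrictDerivAt 0 t).hasDerivAt
  have dPx : ∀ x t, HasDerivAt (fun y => P y t) (-ω * (u x t - u x 0)) x := by
    intro x t
    rw [← int_u']
    exact hasDerivAt_integral_of_continuous (fun x => by fun_prop) (by fun_prop) dz' 0 t x
  have cP' : Continuous fun x => circInt (P x) := continuous_circInt cP
  have cPf : Continuous fun p : ℝ × ℝ => circInt (P p.1) := cP'.comp continuous_fst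
  set Z : ℝ → ℝ → ℝ := fun x t => P x t - circInt (P x) / (2 * Real.pi) with hZ
  have cZ : Continuous (uncurry Z) := cP.sub (cPf.div_const _)
  have dZt : ∀ x t, HasDerivAt (Z x) (z x t) t := fun x t => (dPt x t).sub_const _
  have dZx : ∀ x t, HasDerivAt (fun y => Z y t)
      (-ω * (u x t - circInt (u x) / (2 * Real.pi))) x := by
    intro x t
    refine ((dPx x t).sub ((hasDerivAt_circInt (fun x => by fun_prop)
      (F' := fun x t => -ω * (u x t - u x 0)) (by fun_prop) dPx x).div_const _)).congr_deriv ?_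
    rw [circInt_const_mul, circInt_sub (by fun_prop) (by fun_prop), circInt_const]
    field_simp
    ring
  -- Periodicity is assumed for u only; it passes to v, θ and w by differentiation in ξ and by the
  -- projection.
  have per_z : ∀ x, Periodic (z x) (2 * Real.pi) := by
    have pv := periodic_of_hasDerivAt h.periodic h.u_eq
    have pu₂ := periodic_of_hasDerivAt pv du₂
    have pq : ∀ x, Periodic (q x) (2 * Real.pi) := fun x =>
      galerkin_periodic n (by fun_prop) fun t => by simp only [h.periodic x t]
    have pθ : ∀ x, Periodic (θ x) (2 * Real.pi) := by
      intro x t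
      rw [θ_def]
      simp only [pu₂ x t, pq x t]
    have pw := periodic_of_hasDerivAt pθ h.θ_eq
    intro x t
    rw [hz]
    simp only [pw x t, h.periodic x t]
  have per_Z : ∀ x, Periodic (Z x) (2 * Real.pi) := by
    intro x t
    have e1 : P x (t + 2 * Real.pi) = P x t + ∫ r in t..(t + 2 * Real.pi), z x r :=
      (intervalIntegral.integral_add_adjacent_intervals
        (Continuous.intervalIntegrable (by fun_prop) _ _)
        (Continuous.intervalIntegrable (by fun_prop) _ _)).symm
    have e2 := (per_z x).intervalIntegral_add_eq t 0
    have e3 := z_int' x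
    rw [circInt] at e3
    rw [zero_add, e3] at e2
    simp only [hZ, e1, e2, add_zero]
  -- For finite n, the modes of u and w above n vanish, hence those of z; the modes of `Z` are these
  -- divided by il. With the symmetry of P_n this yields the pairings of `q` with u and `Z`.
  have proj : ∀ x, galerkin n (u x) = u x ∧ galerkin n (Z x) = Z x := by
    intro x
    cases n with
    | top => exact ⟨rfl, rfl⟩
    | coe k =>
      refine ⟨galerkin_eq_self k (by fun_prop) (h.periodic x) fun l hl =>
        (h.fourierMode_eq_zero hs hω cu cv cθ cw cu' du' hbd hl x).1,
        galerkin_eq_self k (by fun_prop) (per_Z x) fun l hl => ?_⟩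
      have hl0 : l ≠ 0 := by rintro rfl; simp at hl; omega
      obtain ⟨m1, m2⟩ := h.fourierMode_eq_zero hs hω cu cv cθ cw cu' du' hbd hl x
      have m3 : fourierMode (z x) l = 0 := by
        have e : z x = fun t => w x t - s * u x t - I * 1 := by rw [hz]; simp
        rw [e, fourierMode_sub (by fun_prop) (by fun_prop),
          fourierMode_sub (by fun_prop) (by fun_prop), fourierMode_const_mul,
          fourierMode_const_mul, m1, m2, fourierMode_one hl0]
        simp
      rw [fourierMode_deriv (dZt x) (by fun_prop) (by simpa using per_Z x 0)] at m3
      have : (l : ℂ) ≠ 0 := by exact_mod_cast hl0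
      simpa [this] using m3
  refine ⟨Z, q, ?_⟩
  constructor
  · exact cu
  · exact cv
  · exact cθ
  · exact cw
  · exact cZ
  · exact cq
  · exact h.u_eq
  · exact v_eq
  · exact h.θ_eq
  · exact dZx
  · intro x t
    have := dZt x t
    rwa [hz] at this
  · intro x
    simpa using per_Z x 0
  · intro x
    rw [circInt_sub (by fun_prop) (by fun_prop), circInt_const]
    field_simp
    simp
  · intro x
    rw [circInt_galerkin_mul n (by fun_prop) (by fun_prop), (proj x).1]
  · intro x
    rw [circInt_galerkin_mul n (by fun_prop) (by fun_prop), (proj x).2]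
  · intro x
    exact circInt_galerkin n (by fun_prop)
  · intro x a ha b hb
    exact abs_integral_galerkin_le n (by fun_prop) ha hb

end IsModulatedWave

/-! ### The uniformly local norm and the conclusion -/

/-- On the k-th unit interval |y| ≥ |k| - 1, and cosh is at least half the exponential of the
modulus; the lost unit costs the factor e^η. -/
lemma inv_cosh_pow_four_le {η : ℝ} (hη : 0 < η) {k : ℤ} {y : ℝ}
    (hy : y ∈ Set.Ioc (k : ℝ) (k + 1)) :
    (Real.cosh (η * y))⁻¹ ^ 4 ≤ (2 * Real.exp η) ^ 4 * Real.exp (-(4 * η)) ^ k.natAbs := by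
  have h1 : (k.natAbs : ℝ) ≤ |y| + 1 := by
    rw [Nat.cast_natAbs, Int.cast_abs, abs_le]
    have h2 := neg_abs_le y
    have h3 := le_abs_self y
    constructor <;> linarith [hy.1, hy.2]
  have h2 : Real.exp (η * |y|) / 2 ≤ Real.cosh (η * y) := by
    rw [← Real.cosh_abs, abs_mul, abs_of_pos hη, Real.cosh_eq]
    have := Real.exp_pos (-(η * |y|))
    linarith
  have h3 : (Real.cosh (η * y))⁻¹ ≤ 2 * Real.exp η * Real.exp (-(η * k.natAbs)) := by
    calc (Real.cosh (η * y))⁻¹ ≤ (Real.exp (η * |y|) / 2)⁻¹ := by gcongr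
      _ = 2 * Real.exp (-(η * |y|)) := by rw [inv_div, Real.exp_neg]; ring
      _ ≤ 2 * Real.exp (η + -(η * k.natAbs)) := by
        gcongr
        nlinarith
      _ = _ := by rw [Real.exp_add]; ring
  have h0 : 0 ≤ (Real.cosh (η * y))⁻¹ := inv_nonneg.2 (Real.cosh_pos _).le
  calc (Real.cosh (η * y))⁻¹ ^ 4 ≤ (2 * Real.exp η * Real.exp (-(η * k.natAbs))) ^ 4 :=
        pow_le_pow_left₀ h0 h3 4
    _ = _ := by
      rw [mul_pow, ← Real.exp_nat_mul, ← Real.exp_nat_mul]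
      congr 2
      push_cast
      ring

lemma summable_pow_natAbs {r : ℝ} (h0 : 0 ≤ r) (h1 : r < 1) :
    Summable fun k : ℤ => r ^ k.natAbs := by
  refine Summable.of_nat_of_neg ?_ ?_ <;> simpa using summable_geometric_of_lt_one h0 h1

/-- Uniform bounds on unit intervals bound the uniformly local norm. -/
lemma exists_unifLpNorm_le {η : ℝ} (hη : 0 < η) :
    ∃ S : ℝ, ∀ (u : ℝ → ℝ → ℝ) (K : ℝ), Continuous (uncurry u) →
      (∀ a : ℝ, ∫ x in a..(a + 1), circInt (fun t => u x t ^ 4) ≤ K) →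
      unifLpNorm η 4 u ≤ ENNReal.ofReal ((S * K) ^ (1 / 4 : ℝ)) := by
  set c : ℤ → ℝ := fun k => (2 * Real.exp η) ^ 4 * Real.exp (-(4 * η)) ^ k.natAbs with hc
  have hc0 : ∀ k, 0 ≤ c k := fun k => by positivity
  have hcs : Summable c := (summable_pow_natAbs (Real.exp_pos _).le
    (by rw [Real.exp_lt_one_iff]; linarith)).mul_left _
  refine ⟨∑' k, c k, fun u K hu hK => iSup_le fun ξ₀ => ?_⟩
  have cm : Continuous fun x => circInt (fun t => u x t ^ 4) := continuous_circInt (by fun_prop)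
  have m0 : ∀ x, 0 ≤ circInt (fun t => u x t ^ 4) := fun x =>
    intervalIntegral.integral_nonneg (by positivity) fun t _ => by positivity
  have hK0 : 0 ≤ K :=
    (intervalIntegral.integral_nonneg (by norm_num) fun x _ => m0 x).trans (hK 0)
  have ch : ∀ x, (Real.cosh (η * (x - ξ₀)))⁻¹ ≥ 0 := fun x => inv_nonneg.2 (Real.cosh_pos _).le
  have cch : Continuous fun x => (Real.cosh (η * (x - ξ₀)))⁻¹ :=
    (by fun_prop : Continuous fun x => Real.cosh (η * (x - ξ₀))).inv₀ fun x => (Real.cosh_pos _).ne'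
  rw [eLpNorm_eq_lintegral_rpow_enorm_toReal (by norm_num) (by norm_num)]
  rw [← ENNReal.ofReal_rpow_of_nonneg (mul_nonneg (tsum_nonneg hc0) hK0) (by norm_num)]
  have e4 : (4 : ENNReal).toReal = 4 := by norm_num
  rw [e4]
  refine ENNReal.rpow_le_rpow ?_ (by norm_num)
  have integrand : ∀ z : ℝ × ℝ, ‖(Real.cosh (η * (z.1 - ξ₀)))⁻¹ * u z.1 z.2‖ₑ ^ (4 : ℝ) =
      ENNReal.ofReal ((Real.cosh (η * (z.1 - ξ₀)))⁻¹ ^ 4) * ENNReal.ofReal (u z.1 z.2 ^ 4) := by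
    intro z
    rw [← ENNReal.ofReal_mul (by have := ch z.1; positivity), ← mul_pow,
      Real.enorm_eq_ofReal_abs, ENNReal.ofReal_rpow_of_nonneg (abs_nonneg _) (by norm_num)]
    congr 1
    have : (4 : ℝ) = ((4 : ℕ) : ℝ) := by norm_num
    rw [this, Real.rpow_natCast, (by decide : Even 4).pow_abs]
  simp only [integrand]
  have hmeas : Measurable fun z : ℝ × ℝ =>
      ENNReal.ofReal ((Real.cosh (η * (z.1 - ξ₀)))⁻¹ ^ 4) * ENNReal.ofReal (u z.1 z.2 ^ 4) := by
    have h1 : Continuous fun z : ℝ × ℝ => (Real.cosh (η * (z.1 - ξ₀)))⁻¹ ^ 4 :=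
      (cch.comp continuous_fst).pow 4
    have h2 : Continuous fun z : ℝ × ℝ => u z.1 z.2 ^ 4 := by fun_prop
    exact h1.measurable.ennreal_ofReal.mul h2.measurable.ennreal_ofReal
  have hvol : (volume : Measure (ℝ × ℝ)).restrict (Set.univ ×ˢ Set.Ioc (0 : ℝ) (2 * Real.pi)) =
      (volume : Measure ℝ).prod (volume.restrict (Set.Ioc (0 : ℝ) (2 * Real.pi))) := by
    rw [Measure.volume_eq_prod, ← Measure.prod_restrict, Measure.restrict_univ]
  rw [hvol, lintegral_prod _ hmeas.aemeasurable]
  have inner : ∀ x, ∫⁻ t in Set.Ioc (0 : ℝ) (2 * Real.pi),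
      ENNReal.ofReal ((Real.cosh (η * (x - ξ₀)))⁻¹ ^ 4) * ENNReal.ofReal (u x t ^ 4) =
      ENNReal.ofReal ((Real.cosh (η * (x - ξ₀)))⁻¹ ^ 4) *
        ENNReal.ofReal (circInt (fun t => u x t ^ 4)) := by
    intro x
    have cx : Continuous fun t => u x t ^ 4 := by fun_prop
    rw [lintegral_const_mul _ cx.measurable.ennreal_ofReal, circInt,
      intervalIntegral.integral_of_le (by positivity),
      ofReal_integral_eq_lintegral_ofReal (cx.integrableOn_Ioc)
        (.of_forall fun t => (by decide : Even 4).pow_nonneg _)]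
  simp only [inner]
  -- The line is cut into unit intervals starting at the centre ξ₀, so the weight bounds, and hence
  -- their sum, do not depend on ξ₀.
  rw [← setLIntegral_univ, ← iUnion_Ioc_add_intCast ξ₀, lintegral_iUnion
    (fun k => measurableSet_Ioc) (Set.pairwise_disjoint_Ioc_add_intCast ξ₀)]
  have piece : ∀ k : ℤ, ∫⁻ x in Set.Ioc (ξ₀ + k) (ξ₀ + k + 1),
      ENNReal.ofReal ((Real.cosh (η * (x - ξ₀)))⁻¹ ^ 4) *
        ENNReal.ofReal (circInt (fun t => u x t ^ 4)) ≤
      ENNReal.ofReal (c k) * ENNReal.ofReal K := by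
    intro k
    calc _ ≤ ∫⁻ x in Set.Ioc (ξ₀ + k) (ξ₀ + k + 1),
          ENNReal.ofReal (c k) * ENNReal.ofReal (circInt (fun t => u x t ^ 4)) := by
          refine setLIntegral_mono (measurable_const.mul
            cm.measurable.ennreal_ofReal) fun x hx => ?_
          gcongr
          exact inv_cosh_pow_four_le hη ⟨by linarith [hx.1], by linarith [hx.2]⟩
      _ = ENNReal.ofReal (c k) *
          ENNReal.ofReal (∫ x in (ξ₀ + k)..(ξ₀ + k + 1), circInt (fun t => u x t ^ 4)) := by
          rw [lintegral_const_mul _ cm.measurable.ennreal_ofReal,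
            intervalIntegral.integral_of_le (by linarith),
            ofReal_integral_eq_lintegral_ofReal (cm.integrableOn_Ioc) (.of_forall m0)]
      _ ≤ _ := by
          gcongr
          exact hK _
  refine (ENNReal.tsum_le_tsum piece).trans_eq ?_
  rw [ENNReal.tsum_mul_right, ← ENNReal.ofReal_tsum_of_nonneg hc0 hcs,
    ← ENNReal.ofReal_mul (tsum_nonneg hc0)]

theorem proposition2p5 (η : ℝ) (hη : 0 < η) :
    ∃ C : ℝ → ℝ → ℝ → ℝ,
      ∀ (n : ℕ∞) (s ω : ℝ) (u v θ w : ℝ → ℝ → ℝ),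
        0 < n → s ≠ 0 → ω ≠ 0 →
        IsModulatedWave n s ω u v θ w →
        ContDiff ℝ (⊤ : ℕ∞) (Function.uncurry u) →
        (∃ M : ℝ, ∀ ξ τ, |u ξ τ| ≤ M) →
        ∀ ξ : ℝ, unifLpNorm η 4 u ≤ ENNReal.ofReal (C (firstIntegral s u w ξ) s ω) := by
  obtain ⟨S, hS⟩ := exists_unifLpNorm_le hη
  -- K is fixed before the wave and the truncation index, so it depends on I, s and ω alone. The
  -- value 0 for s = 0 or ω = 0 is arbitrary.
  have key : ∀ I s ω : ℝ, ∃ K : ℝ, s ≠ 0 → ω ≠ 0 → ∀ u v θ w Z q : ℝ → ℝ → ℝ,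
      WaveProfile s ω I 4 u v θ w Z q → (∃ M : ℝ, ∀ x t, |u x t| ≤ M) → ∀ a : ℝ,
      ∫ x in a..(a + 1), circInt (fun t => u x t ^ 4) ≤ K := by
    intro I s ω
    by_cases hs : s = 0
    · exact ⟨0, fun h => absurd hs h⟩
    by_cases hω : ω = 0
    · exact ⟨0, fun _ h => absurd hω h⟩
    obtain ⟨K, hK⟩ := WaveProfile.exists_mass_bound s ω I 4 hs hω (by norm_num)
    exact ⟨K, fun _ _ => hK⟩
  choose K hK using key
  refine ⟨fun I s ω => (S * K I s ω) ^ (1 / 4 : ℝ), fun n s ω u v θ w _ hs hω h hsm hbd ξ => ?_⟩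
  obtain ⟨Z, q, hp⟩ := h.exists_profile hs hω hsm hbd ξ
  exact hS u _ hsm.continuous (hK _ s ω hs hω u v θ w Z q hp hbd)
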